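/- **Setting.** Let $\Omega\subset\mathbb{R}^N$ be a bounded open set and let $\mathcal{L}u=\sum_{i,j=1}^N\partial_{x_i}(a_{ij}\partial_{x_j}u)$ with measurable coefficients $a_{ij}=a_{ji}:\mathbb{R}^N\to\mathbb{R}$. Assume that $\mathcal L$ is uniformly $X$-elliptic: there are locally Lipschitz vector fields $X_1,\dots,X_m$ on $\mathbb{R}^N$ and a constant $C>0$ with $$\frac1C\sum_{k=1}^m\langle X_k(x),\xi\rangle^2\le\sum_{i,j=1}^N a_{ij}(x)\xi_i\xi_j\le C\sum_{k=1}^m\langle X_k(x),\xi\rangle^2\qquad(x,\xi\in\mathbb{R}^N).$$ Let $H$ be the completion of $C_0^1(\Omega)$ (the $C^1$ functions with compact support in $\Omega$) with respect to $\|u\|_H=\big(\sum_{k}\|X_ku\|_{L^2(\Omega)}^2\big)^{1/2}$, and let $a(\cdot,\cdot)$ be the continuous extension to $H$ of the form $a(u,v)=\int_\Omega\sum_{i,j}a_{ij}\,\partial_{x_i}u\,\partial_{x_j}v\,dx$. Let $Q>2$ be a real number such that $H\hookrightarrow L^p(\Omega)$ for all $p\in[1,\frac{2Q}{Q-2}]$,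 compactly for $p\in[1,\frac{2Q}{Q-2})$. Let $A=-\mathcal{L}$ with homogeneous Dirichlet boundary conditions, that is, the operator in $L^2(\Omega)$ associated with $a$: $u\in D(A)$ and $Au=g$ if and only if $u\in H$, $g\in L^2(\Omega)$ and $a(u,\varphi)=\langle g,\varphi\rangle_{L^2(\Omega)}$ for all $\varphi\in H$. Let $V=H\times L^2(\Omega)$ with $\|(u,v)\|_V^2=a(u,u)+\|v\|_{L^2(\Omega)}^2$, and let $\hat A(u,v)=(v,-Au)$ with domain $D(A)\times H$. Let $f:\mathbb{R}\to\mathbb{R}$ satisfy $$|f(x)-f(y)|\le c\,|x-y|\,(1+|x|^{\gamma}+|y|^{\gamma})\qquad(x,y\in\mathbb{R})$$ for some $c\ge0$ and $0<\gamma\le\frac{q-2}{2}$, where $q=\frac{2Q}{Q-2}$. Let $\beta:\mathbb{R}\to\mathbb{R}$ be continuous with $$1\le\int_t^{t+1}\beta(\tau)\,d\tau\le C_\beta\quad(t\in\mathbb{R})\qquad\text{and}\qquad\int_{-\infty}^{\infty}\max\{-\beta(\tau),0\}\,d\tau<\infty$$ for some constant $C_\beta\ge1$. Put $\hat f(t,(u,v))=(0,-\beta(t)v+f(u))$.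 **Solutions.** Let $s\in\mathbb{R}$, $s<T\le\infty$ and $w_0=(u_0,v_0)\in V$. A *weak solution* on $[s,T)$ of $\partial_{tt}u+\beta(t)\partial_tu=\mathcal{L}u+f(u)$ in $\Omega$, $u=0$ on $\partial\Omega$, with initial value $w_0$ at time $s$, is a function $u\in C([s,T);H)\cap C^1((s,T);L^2(\Omega))$ with $u(s)=u_0$ and $\partial_tu(s)=v_0$ (one-sided derivative in $L^2(\Omega)$) such that for all $\varphi\in H$ and $t\in(s,T)$ $$\frac{d^2}{dt^2}\langle u(t),\varphi\rangle_{L^2(\Omega)}+\beta(t)\frac{d}{dt}\langle u(t),\varphi\rangle_{L^2(\Omega)}=-a(u(t),\varphi)+\langle f(u(t)),\varphi\rangle_{L^2(\Omega)}.$$ It is identified with $w=(u,\partial_tu)$. A *mild solution* on $[s,T)$ with initial value $w_0$ is a function $w\in C([s,T);V)$ with $$w(t)=e^{\hat A(t-s)}w_0+\int_s^te^{\hat A(t-\tau)}\hat f(\tau,w(\tau))\,d\tau\qquad(s\le t<T).$$ **Theorem.** The map $u\mapsto f(u)$ sends $H$ into $L^2(\Omega)$, and $\hat A$ generates a strongly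 continuous semigroup $(e^{\hat At})_{t\ge0}$ of bounded operators on $V$. For every $s\in\mathbb{R}$ and every $w_0\in V$ there are $T\in(s,\infty]$ and a function $w=(u,\partial_tu)$ on $[s,T)$ which is both a weak solution and a mild solution on $[s,T)$ with initial value $w_0$ (so the variation of constants formula holds), and $$w\in C([s,T);V)\cap C^1\big((s,T);L^2(\Omega)\times H^*\big),$$ where $L^2(\Omega)\to H^*$ by $g\mapsto\langle g,\cdot\rangle_{L^2(\Omega)}$. The solution is unique and $[s,T)$ is maximal: every weak or mild solution with initial value $w_0$ on an interval $[s,T')$, $s<T'\le\infty$, satisfies $T'\le T$ and coincides with $w$ on $[s,T')$. Finally, either $T=\infty$, or $T<\infty$ and $\limsup_{t\to T^-}\|w(t)\|_V=\infty$. -/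

import Mathlib

open MeasureTheory Set Filter Topology
open scoped ENNReal NNReal

noncomputable section

namespace DampedWave

/-- `ℝ^N` with its Euclidean structure. -/
abbrev Eu (N : ℕ) : Type := EuclideanSpace ℝ (Fin N)

/-- The data of a uniformly `X`-elliptic operator `ℒ u = ∑ ∂_i (a_ij ∂_j u)` on `ℝ^N`:
measurable symmetric coefficients `a`, locally Lipschitz vector fields `X_1, …, X_m`, and the
two-sided bound of the quadratic form of `a` by `∑_k ⟨X_k, ξ⟩²`. -/
structure XEllipticOperator (N m : ℕ) where
  a : Eu N → Matrix (Fin N) (Fin N) ℝ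
  X : Fin m → Eu N → Eu N
  measurable_a : ∀ i j, Measurable fun x => a x i j
  symm_a : ∀ x i j, a x i j = a x j i
  locallyLipschitz_X : ∀ k, LocallyLipschitz (X k)
  elliptic : ∃ C : ℝ, 0 < C ∧ ∀ x ξ : Eu N,
    C⁻¹ * ∑ k, (inner ℝ (X k x) ξ) ^ 2 ≤ ∑ i, ∑ j, a x i j * ξ i * ξ j ∧
    ∑ i, ∑ j, a x i j * ξ i * ξ j ≤ C * ∑ k, (inner ℝ (X k x) ξ) ^ 2

/-- `C_0^1(Ω)`: functions of class `C¹` with compact support contained in `Ω`. -/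
def C01 {N : ℕ} (Ω : Set (Eu N)) : Submodule ℝ (Eu N → ℝ) where
  carrier := {u | ContDiff ℝ 1 u ∧ HasCompactSupport u ∧ tsupport u ⊆ Ω}
  zero_mem' := ⟨contDiff_const, HasCompactSupport.zero, by simp [tsupport]⟩
  add_mem' := fun {u v} hu hv => ⟨hu.1.add hv.1, hu.2.1.add hv.2.1,
    (tsupport_add u v).trans (union_subset hu.2.2 hv.2.2)⟩
  smul_mem' := fun c u hu => ⟨contDiff_const.smul hu.1,
    hu.2.1.mono (Function.support_const_smul_subset c u),
    (closure_mono (Function.support_const_smul_subset c u)).trans hu.2.2⟩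

/-- The real Hilbert space `L²(Ω)`. -/
abbrev L2 {N : ℕ} (Ω : Set (Eu N)) : Type := Lp ℝ 2 (volume.restrict Ω)

/-- The partial derivative `∂_i u`. -/
def partialDeriv {N : ℕ} (i : Fin N) (u : Eu N → ℝ) (x : Eu N) : ℝ :=
  fderiv ℝ u x (EuclideanSpace.single i 1)

lemma C01.continuous_partialDeriv {N : ℕ} {Ω : Set (Eu N)} (u : C01 Ω) (i : Fin N) :
    Continuous (partialDeriv i (u : Eu N → ℝ)) :=
  (u.2.1.continuous_fderiv one_ne_zero).clm_apply continuous_const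

lemma C01.hasCompactSupport_partialDeriv {N : ℕ} {Ω : Set (Eu N)} (u : C01 Ω) (i : Fin N) :
    HasCompactSupport (partialDeriv i (u : Eu N → ℝ)) :=
  (u.2.2.1.fderiv (𝕜 := ℝ)).comp_left (g := fun A : Eu N →L[ℝ] ℝ => A (EuclideanSpace.single i 1))
    (by simp)

lemma C01.memLp {N : ℕ} {Ω : Set (Eu N)} (u : C01 Ω) (p : ℝ≥0∞) :
    MemLp (u : Eu N → ℝ) p (volume.restrict Ω) :=
  (u.2.1.continuous.memLp_of_hasCompactSupport u.2.2.1).restrict Ω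

/-- The inclusion `C_0^1(Ω) → L²(Ω)`. -/
def C01.toL2 {N : ℕ} (Ω : Set (Eu N)) : C01 Ω →ₗ[ℝ] L2 Ω where
  toFun u := (C01.memLp u 2).toLp
  map_add' u v := MemLp.toLp_add (C01.memLp u 2) (C01.memLp v 2)
  map_smul' c u := MemLp.toLp_const_smul c (C01.memLp u 2)

namespace XEllipticOperator

variable {N m : ℕ} (L : XEllipticOperator N m) (Ω : Set (Eu N))

/-- `‖u‖_H = (∑_k ‖X_k u‖²_{L²(Ω)})^{1/2}` for `u ∈ C_0^1(Ω)`, where `X_k u (x) = Du(x)(X_k(x))`. -/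
def normH (u : C01 Ω) : ℝ :=
  Real.sqrt (∑ k, ∫ x in Ω, (fderiv ℝ (u : Eu N → ℝ) x (L.X k x)) ^ 2)

/-- The form `a(u, v) = (-ℒ u, v) = ∫_Ω ∑ a_ij ∂_i u ∂_j v` on `C_0^1(Ω)`. -/
def form (u v : C01 Ω) : ℝ :=
  ∫ x in Ω, ∑ i, ∑ j, L.a x i j * partialDeriv i u x * partialDeriv j v x

lemma quad_nonneg (x ξ : Eu N) : 0 ≤ ∑ i, ∑ j, L.a x i j * ξ i * ξ j := by
  obtain ⟨C, hC, h⟩ := L.elliptic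
  exact le_trans (mul_nonneg (inv_nonneg.2 hC.le) (Finset.sum_nonneg fun _ _ => sq_nonneg _))
    (h x ξ).1

lemma abs_coeff_le : ∃ C : ℝ, ∀ x i j,
    |L.a x i j| ≤ C * ∑ k, ((L.X k x i) ^ 2 + (L.X k x j) ^ 2) := by
  obtain ⟨C, hC, h⟩ := L.elliptic
  refine ⟨C, fun x i j => ?_⟩
  have key : ∀ (c d : ℝ), ∑ i', ∑ j', L.a x i' j' *
      ((EuclideanSpace.single i c + EuclideanSpace.single j d : Eu N) i') *
      ((EuclideanSpace.single i c + EuclideanSpace.single j d : Eu N) j')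
      = c ^ 2 * L.a x i i + c * d * L.a x i j + c * d * L.a x j i + d ^ 2 * L.a x j j := by
    intro c d
    simp [add_mul, mul_add, Finset.sum_add_distrib]
    ring
  have diag : ∀ i, L.a x i i ≤ C * ∑ k, (L.X k x i) ^ 2 := by
    intro i
    have := (h x (EuclideanSpace.single i 1)).2
    simpa [Pi.single_apply, EuclideanSpace.inner_single_right] using this
  have h1 := L.quad_nonneg x (EuclideanSpace.single i 1 + EuclideanSpace.single j 1)
  have h2 := L.quad_nonneg x (EuclideanSpace.single i 1 + EuclideanSpace.single j (-1))
  have h3 := L.quad_nonneg x (EuclideanSpace.single i 1 + EuclideanSpace.single j 0)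
  have h4 := L.quad_nonneg x (EuclideanSpace.single i 0 + EuclideanSpace.single j 1)
  rw [key] at h1 h2 h3 h4
  have hs := L.symm_a x i j
  have d1 := diag i
  have d2 := diag j
  rw [Finset.sum_add_distrib, mul_add, abs_le]
  constructor <;> nlinarith

lemma integrable_form (u v : C01 Ω) (i j : Fin N) :
    Integrable (fun x => L.a x i j * partialDeriv i u x * partialDeriv j v x)
      (volume.restrict Ω) := by
  obtain ⟨C, hC⟩ := L.abs_coeff_le
  have hX : ∀ k, Continuous (L.X k) := fun k => (L.locallyLipschitz_X k).continuous
  have hcoord : ∀ k i, Continuous fun x => L.X k x i := fun k i =>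
    (EuclideanSpace.proj (𝕜 := ℝ) i).continuous.comp (hX k)
  have hu := C01.continuous_partialDeriv u i
  have hv := C01.continuous_partialDeriv v j
  have hg : Continuous fun x => (C * ∑ k, ((L.X k x i) ^ 2 + (L.X k x j) ^ 2)) *
      partialDeriv i (u : Eu N → ℝ) x * partialDeriv j (v : Eu N → ℝ) x := by
    refine (Continuous.mul ?_ hu).mul hv
    exact continuous_const.mul (continuous_finsetSum _ fun k _ =>
      ((hcoord k i).pow 2).add ((hcoord k j).pow 2))
  have hgi := hg.integrable_of_hasCompactSupport (μ := volume)
    ((C01.hasCompactSupport_partialDeriv v j).mul_left)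
  refine (hgi.norm.mono' ?_ ?_).restrict
  · exact (((L.measurable_a i j).mul hu.measurable).mul hv.measurable).aestronglyMeasurable
  · refine Eventually.of_forall fun x => ?_
    simp only [norm_mul, Real.norm_eq_abs]
    have := (hC x i j).trans (le_abs_self _)
    rw [abs_mul] at this
    gcongr

lemma partialDeriv_add (u v : C01 Ω) (i : Fin N) (x : Eu N) :
    partialDeriv i ((u + v : C01 Ω) : Eu N → ℝ) x = partialDeriv i u x + partialDeriv i v x := by
  have hu := (u.2.1.differentiable one_ne_zero) x
  have hv := (v.2.1.differentiable one_ne_zero) x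
  simp [partialDeriv, fderiv_add hu hv]

lemma partialDeriv_smul (c : ℝ) (u : C01 Ω) (i : Fin N) (x : Eu N) :
    partialDeriv i ((c • u : C01 Ω) : Eu N → ℝ) x = c * partialDeriv i u x := by
  have hu := (u.2.1.differentiable one_ne_zero) x
  simp [partialDeriv, fderiv_const_smul hu]

lemma form_comm (u v : C01 Ω) : L.form Ω v u = L.form Ω u v := by
  unfold form
  congr 1
  ext x
  rw [Finset.sum_comm]
  refine Finset.sum_congr rfl fun i _ => Finset.sum_congr rfl fun j _ => ?_
  rw [L.symm_a x j i]
  ring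

lemma form_self_nonneg (u : C01 Ω) : 0 ≤ L.form Ω u u :=
  integral_nonneg fun x =>
    L.quad_nonneg x (WithLp.toLp 2 fun i => partialDeriv i (u : Eu N → ℝ) x)

lemma form_add_left (u v w : C01 Ω) :
    L.form Ω (u + v) w = L.form Ω u w + L.form Ω v w := by
  unfold form
  rw [← integral_add]
  · simp only [← Finset.sum_add_distrib]
    congr 1
    ext x
    refine Finset.sum_congr rfl fun i _ => Finset.sum_congr rfl fun j _ => ?_
    rw [partialDeriv_add]
    ring
  · exact integrable_finsetSum _ fun i _ => integrable_finsetSum _ fun j _ =>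
      L.integrable_form Ω u w i j
  · exact integrable_finsetSum _ fun i _ => integrable_finsetSum _ fun j _ =>
      L.integrable_form Ω v w i j

lemma form_smul_left (u v : C01 Ω) (c : ℝ) : L.form Ω (c • u) v = c * L.form Ω u v := by
  unfold form
  rw [← integral_const_mul]
  simp only [Finset.mul_sum]
  congr 1
  ext x
  refine Finset.sum_congr rfl fun i _ => Finset.sum_congr rfl fun j _ => ?_
  rw [partialDeriv_smul]
  ring

/-- `C_0^1(Ω)` equipped with the form `a(·,·)`. -/
def PreEnergy (_L : XEllipticOperator N m) (Ω : Set (Eu N)) : Type := C01 Ω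

instance : AddCommGroup (L.PreEnergy Ω) := inferInstanceAs (AddCommGroup (C01 Ω))
instance : Module ℝ (L.PreEnergy Ω) := inferInstanceAs (Module ℝ (C01 Ω))

instance : PreInnerProductSpace.Core ℝ (L.PreEnergy Ω) where
  inner u v := L.form Ω u v
  conj_inner_symm u v := L.form_comm Ω u v
  re_inner_nonneg u := L.form_self_nonneg Ω u
  add_left u v w := L.form_add_left Ω u v w
  smul_left u v c := L.form_smul_left Ω u v c

instance : SeminormedAddCommGroup (L.PreEnergy Ω) :=
  InnerProductSpace.Core.toSeminormedAddCommGroup (𝕜 := ℝ)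

instance : InnerProductSpace ℝ (L.PreEnergy Ω) := InnerProductSpace.ofCore _

/-- The squares of the norms given by `a(·,·)` and by `‖·‖_H` are comparable on `C_0^1(Ω)`. -/
lemma form_equiv_normH : ∃ C : ℝ, 0 < C ∧ ∀ u : C01 Ω,
    C⁻¹ * L.normH Ω u ^ 2 ≤ L.form Ω u u ∧ L.form Ω u u ≤ C * L.normH Ω u ^ 2 := by
  obtain ⟨C, hC, h⟩ := L.elliptic
  refine ⟨C, hC, fun u => ?_⟩
  have hX : ∀ k, Integrable (fun x => (fderiv ℝ (u : Eu N → ℝ) x (L.X k x)) ^ 2)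
      (volume.restrict Ω) := by
    intro k
    have hc : Continuous fun x => fderiv ℝ (u : Eu N → ℝ) x (L.X k x) :=
      (u.2.1.continuous_fderiv one_ne_zero).clm_apply (L.locallyLipschitz_X k).continuous
    refine ((hc.pow 2).integrable_of_hasCompactSupport (μ := volume) ?_).restrict
    refine (u.2.2.1.fderiv (𝕜 := ℝ)).mono fun x hx => ?_
    simp only [Function.mem_support] at hx ⊢
    intro h0
    simp [h0] at hx
  have hn : L.normH Ω u ^ 2 =
      ∫ x in Ω, ∑ k, (fderiv ℝ (u : Eu N → ℝ) x (L.X k x)) ^ 2 := by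
    rw [normH, Real.sq_sqrt (Finset.sum_nonneg fun k _ => integral_nonneg fun x => sq_nonneg _),
      integral_finsetSum _ fun k _ => hX k]
  have hgrad : ∀ x (w : Eu N), inner ℝ w
      (WithLp.toLp 2 fun i => partialDeriv i (u : Eu N → ℝ) x) =
      fderiv ℝ (u : Eu N → ℝ) x w := by
    intro x w
    conv_rhs => rw [← (EuclideanSpace.basisFun (Fin N) ℝ).sum_repr w]
    simp [partialDeriv, PiLp.inner_apply, mul_comm]
  have hi1 : Integrable (fun x => ∑ k, (fderiv ℝ (u : Eu N → ℝ) x (L.X k x)) ^ 2)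
      (volume.restrict Ω) := integrable_finsetSum _ fun k _ => hX k
  have hi2 : Integrable (fun x => ∑ i, ∑ j,
      L.a x i j * partialDeriv i (u : Eu N → ℝ) x * partialDeriv j (u : Eu N → ℝ) x)
      (volume.restrict Ω) :=
    integrable_finsetSum _ fun i _ => integrable_finsetSum _ fun j _ =>
      L.integrable_form Ω u u i j
  rw [hn, form, ← integral_const_mul, ← integral_const_mul]
  constructor
  · refine integral_mono (hi1.const_mul _) hi2 fun x => ?_
    have := (h x (WithLp.toLp 2 fun i => partialDeriv i (u : Eu N → ℝ) x)).1
    simpa only [hgrad] using this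
  · refine integral_mono hi2 (hi1.const_mul _) fun x => ?_
    have := (h x (WithLp.toLp 2 fun i => partialDeriv i (u : Eu N → ℝ) x)).2
    simpa only [hgrad] using this

/-- The Hilbert space `H`: the completion of `C_0^1(Ω)`. Its inner product is the (extended) form
`a(·,·)`, whose norm is equivalent to `‖·‖_H` by `form_equiv_normH`. -/
abbrev H : Type := UniformSpace.Completion (L.PreEnergy Ω)

/-- The canonical map `C_0^1(Ω) → H`. -/
def ofC01 : C01 Ω →ₗ[ℝ] L.H Ω :=
  (UniformSpace.Completion.toComplₗᵢ (𝕜 := ℝ) (E := L.PreEnergy Ω)).toLinearMap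

lemma denseRange_ofC01 : DenseRange (L.ofC01 Ω) :=
  UniformSpace.Completion.denseRange_coe (α := L.PreEnergy Ω)

lemma inner_ofC01 (u v : C01 Ω) : inner ℝ (L.ofC01 Ω u) (L.ofC01 Ω v) = L.form Ω u v :=
  UniformSpace.Completion.inner_coe (𝕜 := ℝ) (E := L.PreEnergy Ω) u v

/-- The embedding `H ↪ L^p(Ω)` for `1 ≤ p ≤ 2Q/(Q-2)`, compact for `1 ≤ p < 2Q/(Q-2)`,
expressed on the dense subspace `C_0^1(Ω)` of `H`. -/
def SobolevEmbedding (Q : ℝ) : Prop :=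
  (∀ p : ℝ, 1 ≤ p → p ≤ 2 * Q / (Q - 2) → ∃ C : ℝ, ∀ u : C01 Ω,
    eLpNorm (u : Eu N → ℝ) (ENNReal.ofReal p) (volume.restrict Ω)
      ≤ ENNReal.ofReal (C * L.normH Ω u)) ∧
  (∀ p : ℝ, 1 ≤ p → p < 2 * Q / (Q - 2) → ∀ u : ℕ → C01 Ω,
    (∃ M : ℝ, ∀ n, L.normH Ω (u n) ≤ M) →
    ∃ k : ℕ → ℕ, StrictMono k ∧
      Tendsto (fun ij : ℕ × ℕ => eLpNorm ((u (k ij.1) : Eu N → ℝ) - (u (k ij.2) : Eu N → ℝ))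
        (ENNReal.ofReal p) (volume.restrict Ω)) atTop (𝓝 0))

/-- The embedding `H → L²(Ω)`: the continuous extension to `H` of the inclusion
`C_0^1(Ω) ⊆ L²(Ω)` (which is bounded under `SobolevEmbedding`). -/
def toL2 : L.H Ω →L[ℝ] L2 Ω := LinearMap.extendOfNorm (C01.toL2 Ω) (L.ofC01 Ω)

lemma toL2_ofC01 {Q : ℝ} (hQ : 2 < Q) (h : L.SobolevEmbedding Ω Q) (u : C01 Ω) :
    L.toL2 Ω (L.ofC01 Ω u) = C01.toL2 Ω u := by
  refine LinearMap.extendOfNorm_eq (L.denseRange_ofC01 Ω) ?_ u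
  obtain ⟨C, hC⟩ := h.1 2 (by norm_num) (by rw [le_div_iff₀ (by linarith)]; linarith)
  obtain ⟨D, hD, hDD⟩ := L.form_equiv_normH Ω
  refine ⟨|C| * Real.sqrt D, fun v => ?_⟩
  have h1 := hC v
  have h2 := (hDD v).1
  rw [← L.inner_ofC01, real_inner_self_eq_norm_sq, inv_mul_le_iff₀ hD] at h2
  have hnn : 0 ≤ L.normH Ω v := Real.sqrt_nonneg _
  have h3 : ‖C01.toL2 Ω v‖ ≤ |C| * L.normH Ω v := by
    have e : ‖C01.toL2 Ω v‖ = (eLpNorm (v : Eu N → ℝ) 2 (volume.restrict Ω)).toReal :=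
      Lp.norm_toLp _ (C01.memLp v 2)
    rw [e]
    refine ENNReal.toReal_le_of_le_ofReal (by positivity) ?_
    refine le_trans (by simpa using h1) (ENNReal.ofReal_le_ofReal ?_)
    gcongr
    exact le_abs_self C
  refine h3.trans ?_
  rw [mul_assoc]
  gcongr
  rw [← Real.sqrt_sq (norm_nonneg (L.ofC01 Ω v)), ← Real.sqrt_mul hD.le]
  exact Real.le_sqrt_of_sq_le h2

/-- The map `L²(Ω) → H*`, `g ↦ (φ ↦ ⟨g, φ⟩_{L²})`. -/
def toDual : L2 Ω →L[ℝ] (L.H Ω →L[ℝ] ℝ) :=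
  (ContinuousLinearMap.precomp ℝ (L.toL2 Ω)).comp (innerSL ℝ : L2 Ω →L[ℝ] L2 Ω →L[ℝ] ℝ)

/-- The phase space `V = H × L²(Ω)`, with `‖(u, v)‖_V² = a(u, u) + ‖v‖²_{L²}`. -/
abbrev V : Type := WithLp 2 (L.H Ω × L2 Ω)

/-- The graph of `A = -ℒ` with homogeneous Dirichlet boundary conditions, the operator in `L²(Ω)`
associated with the form `a`: `u ∈ D(A)` and `A u = g` if and only if `u ∈ H`, `g ∈ L²(Ω)` and
`a(u, φ) = ⟨g, φ⟩_{L²}` for all `φ ∈ H`. -/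
def graphA : Set (L.H Ω × L2 Ω) :=
  {p | ∀ φ : L.H Ω, inner ℝ p.1 φ = inner ℝ p.2 (L.toL2 Ω φ)}

/-- The graph of the operator `Â (u, v) = (v, -A u)` in `V`, with domain `D(A) × H`. -/
def graphAhat : Set (L.V Ω × L.V Ω) :=
  {p | L.toL2 Ω p.2.fst = p.1.snd ∧ (p.1.fst, -p.2.snd) ∈ L.graphA Ω}

/-- The Nemytskii operator `u ↦ f ∘ u` in `L²(Ω)` (only used where `f ∘ u ∈ L²(Ω)`). -/
def _root_.DampedWave.nemytskii {N : ℕ} (Ω : Set (Eu N)) (f : ℝ → ℝ) (u : L2 Ω) : L2 Ω :=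
  open Classical in
  if h : MemLp (fun x => f (u x)) 2 (volume.restrict Ω) then h.toLp else 0

/-- `f̂(t, (u, v)) = (0, -β(t) v + f(u))`. -/
def fhat (f β : ℝ → ℝ) (t : ℝ) (w : L.V Ω) : L.V Ω :=
  WithLp.toLp 2 (0, -(β t • w.snd) + nemytskii Ω f (L.toL2 Ω w.fst))

end XEllipticOperator

/-- `S` (restricted to `t ≥ 0`) is a strongly continuous semigroup of bounded operators whose
infinitesimal generator is the operator with graph `G`, i.e. `S t = e^{tG}`. -/
structure IsSemigroupGeneratedBy {E : Type*} [NormedAddCommGroup E] [NormedSpace ℝ E]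
    (S : ℝ → E →L[ℝ] E) (G : Set (E × E)) : Prop where
  zero : S 0 = ContinuousLinearMap.id ℝ E
  add : ∀ t r : ℝ, 0 ≤ t → 0 ≤ r → S (t + r) = (S t).comp (S r)
  continuousOn : ∀ x, ContinuousOn (fun t => S t x) (Ici 0)
  generator : ∀ x y, (x, y) ∈ G ↔ Tendsto (fun t : ℝ => t⁻¹ • (S t x - x)) (𝓝[>] 0) (𝓝 y)

/-- The real interval `[s, T)`, where `T ≤ ∞`. -/
def timeIco (s : ℝ) (T : EReal) : Set ℝ := {t | s ≤ t ∧ (t : EReal) < T}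

/-- The real interval `(s, T)`, where `T ≤ ∞`. -/
def timeIoo (s : ℝ) (T : EReal) : Set ℝ := {t | s < t ∧ (t : EReal) < T}

namespace XEllipticOperator

variable {N m : ℕ} (L : XEllipticOperator N m) (Ω : Set (Eu N))

/-- `w = (u, ∂_t u)` for a weak solution `u` on `[s, T)` of
`∂_tt u + β(t) ∂_t u = ℒ u + f(u)`, `u|_{∂Ω} = 0`, `(u, ∂_t u)(s) = w₀`:
`u ∈ C([s, T); H) ∩ C¹((s, T); L²(Ω))`, the second component of `w` is `∂_t u` on `(s, T)` and the
one-sided derivative at `s`, and for all `φ ∈ H` the scalar equation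
`d²/dt² ⟨u, φ⟩ + β d/dt ⟨u, φ⟩ = -a(u, φ) + ⟨f(u), φ⟩` holds on `(s, T)`. -/
structure IsWeakSolution (f β : ℝ → ℝ) (s : ℝ) (T : EReal) (w₀ : L.V Ω) (w : ℝ → L.V Ω) :
    Prop where
  continuousOn : ContinuousOn (fun t => (w t).fst) (timeIco s T)
  contDiffOn : ContDiffOn ℝ 1 (fun t => L.toL2 Ω (w t).fst) (timeIoo s T)
  hasDerivAt : ∀ t ∈ timeIoo s T, HasDerivAt (fun τ => L.toL2 Ω (w τ).fst) (w t).snd t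
  initial : w s = w₀
  hasDerivWithinAt_initial :
    HasDerivWithinAt (fun τ => L.toL2 Ω (w τ).fst) (w s).snd (Ici s) s
  equation : ∀ t ∈ timeIoo s T, ∀ φ : L.H Ω,
    ∃ D : ℝ, HasDerivAt (fun τ => inner ℝ (w τ).snd (L.toL2 Ω φ)) D t ∧
      D + β t * inner ℝ (w t).snd (L.toL2 Ω φ) =
        -inner ℝ (w t).fst φ +
          inner ℝ (nemytskii Ω f (L.toL2 Ω (w t).fst)) (L.toL2 Ω φ)

/-- `w` is a mild solution on `[s, T)` with initial value `w₀`: it is continuous with values in `V`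
and satisfies the variation of constants formula, where `S t = e^{tÂ}`. -/
structure IsMildSolution (S : ℝ → L.V Ω →L[ℝ] L.V Ω) (f β : ℝ → ℝ) (s : ℝ) (T : EReal)
    (w₀ : L.V Ω) (w : ℝ → L.V Ω) : Prop where
  continuousOn : ContinuousOn w (timeIco s T)
  intervalIntegrable : ∀ t ∈ timeIco s T,
    IntervalIntegrable (fun τ => S (t - τ) (L.fhat Ω f β τ (w τ))) volume s t
  formula : ∀ t ∈ timeIco s T,
    w t = S (t - s) w₀ + ∫ τ in s..t, S (t - τ) (L.fhat Ω f β τ (w τ))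

end XEllipticOperator
end DampedWave

end

open DampedWave

/-!
The wave operator `Â (u, v) = (v, -A u)` has a bounded inverse. With `ι : H → L²(Ω)` the embedding
and `ι*` its adjoint, `A⁻¹ = ι*` and `Â⁻¹ (g, h) = (-ι* h, ι g)`; this is `waveInv`, a bounded
skew-symmetric operator `K` on `V`, and the graph of `Â` is `{(K y, y)}` (`graphAhat_eq`). The whole
argument is phrased with `K`, so that no unbounded operator has to be handled.

* *Injectivity of `K`.* It needs `ι` to be injective and to have dense range. The first
  (`toL2_injective`) says that the form is closable. As `X_k` is locally Lipschitz, one may integrate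
  by parts in `∫ (X_k u) φ`, so the extension of `X_k u` to `u ∈ H` vanishes once `ι u = 0`, and
  these derivatives control the norm of `u`.
* *The semigroup* (`exists_isUnitaryGroup`). The operators `-(ε - K²)⁻¹ K` are bounded and
  skew-symmetric and converge strongly to `K⁻¹` on the range of `K`; their exponentials are
  isometries and converge to a group of isometries `S(t) = e^{tÂ}`.
* *Reduction to an ordinary differential equation.* By the Sobolev and Hölder inequalities
  `u ↦ f(u)` is Lipschitz from bounded sets of `H` to `L²(Ω)`
  (`exists_lipschitzOnWith_nemytskii`). Since `S` is a group, `w` is a mild solution if and only if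
  `z(t) = S(-t) w(t)` solves `z' = G(t, z)` with `G(t, z) = S(-t) f̂(t, S(t) z)`, a field which is
  continuous in time and Lipschitz on bounded sets. The Picard–Lindelöf theorem provides a unique
  maximal solution with the blow-up alternative (`IsLipschitzField.exists_maximal`), and
  `‖z(t)‖ = ‖w(t)‖`.
* *Weak and mild solutions coincide.* Both are characterised by `(K w)' = w + K f̂(t, w)`, an
  identity in `V` whose two components are `∂_t u = v` and the weak equation
  (`hasDerivWithinAt_waveInv`, `IsWeakSolution.hasDerivAt_waveInv`). A weak solution is not assumed
  to have `∂_t u` continuous at the initial time. That it is follows from a backward Gronwall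
  estimate, which makes `z` Lipschitz near `s` (`IsWeakSolution.tendsto_initial`).
-/

noncomputable section

namespace DampedWave

/-! ### Groups of isometries generated by the inverse of a skew-symmetric operator -/

section UnitaryGroup

open NormedSpace

variable {E : Type*} [NormedAddCommGroup E] [InnerProductSpace ℝ E]

/-- `S` is a strongly continuous group of linear isometries whose generator is `K⁻¹`, the
(unbounded) inverse of the bounded operator `K`: it commutes with `K`, and `t ↦ S t (K y)` is
differentiable with derivative `S t y`. -/
structure IsUnitaryGroup (S : ℝ → E →L[ℝ] E) (K : E →L[ℝ] E) : Prop where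
  zero : S 0 = ContinuousLinearMap.id ℝ E
  add : ∀ t r, S (t + r) = (S t).comp (S r)
  norm_map : ∀ t x, ‖S t x‖ = ‖x‖
  continuous : ∀ x, Continuous fun t => S t x
  comm : ∀ t x, S t (K x) = K (S t x)
  hasDerivAt : ∀ y t, HasDerivAt (fun τ => S τ (K y)) (S t y) t

variable {K : E →L[ℝ] E}

namespace IsUnitaryGroup

variable {S : ℝ → E →L[ℝ] E}

lemma apply_neg_apply (h : IsUnitaryGroup S K) (t : ℝ) (x : E) : S t (S (-t) x) = x := by
  rw [← ContinuousLinearMap.comp_apply, ← h.add]; simp [h.zero]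

lemma neg_apply_apply (h : IsUnitaryGroup S K) (t : ℝ) (x : E) : S (-t) (S t x) = x := by
  rw [← ContinuousLinearMap.comp_apply, ← h.add]; simp [h.zero]

lemma apply_sub (h : IsUnitaryGroup S K) (t r : ℝ) (x : E) : S (t - r) x = S t (S (-r) x) := by
  rw [← ContinuousLinearMap.comp_apply, ← h.add, sub_eq_add_neg]

/-- Strong continuity together with isometry gives joint continuity. -/
lemma continuous_uncurry (h : IsUnitaryGroup S K) : Continuous fun p : ℝ × E => S p.1 p.2 := by
  rw [continuous_iff_continuousAt]
  rintro ⟨t, x⟩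
  have h1 : Tendsto (fun p : ℝ × E => S p.1 (p.2 - x)) (𝓝 (t, x)) (𝓝 0) := by
    rw [tendsto_zero_iff_norm_tendsto_zero]
    simp only [h.norm_map]
    have : Tendsto (fun p : ℝ × E => ‖p.2 - x‖) (𝓝 (t, x)) (𝓝 ‖x - x‖) :=
      ((continuous_snd.sub continuous_const).norm).tendsto _
    simpa using this
  have h2 : Tendsto (fun p : ℝ × E => S p.1 x) (𝓝 (t, x)) (𝓝 (S t x)) :=
    ((h.continuous x).comp continuous_fst).tendsto _
  simpa [ContinuousAt] using h1.add h2

/-- The generator of the group is `K⁻¹`. -/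
lemma isSemigroupGeneratedBy (h : IsUnitaryGroup S K) :
    IsSemigroupGeneratedBy S {p | p.1 = K p.2} where
  zero := h.zero
  add t r _ _ := h.add t r
  continuousOn x := (h.continuous x).continuousOn
  generator x y := by
    have key : ∀ y, Tendsto (fun t : ℝ => t⁻¹ • (S t (K y) - K y)) (𝓝[>] 0) (𝓝 y) := by
      intro y
      have := (h.hasDerivAt y 0).tendsto_slope_zero_right
      simpa [h.zero] using this
    constructor
    · rintro (rfl : x = K y)
      exact key y
    · intro hx
      have h1 := (K.continuous.tendsto y).comp hx
      refine tendsto_nhds_unique (key x) (h1.congr fun t => ?_)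
      simp [h.comm]

end IsUnitaryGroup

lemma exp_smul_comm_apply {C D : E →L[ℝ] E} (h : Commute C D) (x : E) (t : ℝ) :
    exp (t • C) (D x) = D (exp (t • C) x) :=
  DFunLike.congr_fun ((h.smul_left t).exp_left).eq x

lemma inner_apply_self_of_skew (hK : ∀ x y, inner ℝ (K x) y = -inner ℝ x (K y)) (x : E) :
    inner ℝ (K x) x = 0 := by
  have := hK x x
  rw [real_inner_comm] at this
  have h2 := real_inner_comm x (K x)
  linarith

/-- `ε - K²`, a positive definite operator when `K` is skew-symmetric and `ε > 0`. -/
def shiftSq (K : E →L[ℝ] E) (ε : ℝ) : E →L[ℝ] E := ε • 1 - K * K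

lemma inner_shiftSq (hK : ∀ x y, inner ℝ (K x) y = -inner ℝ x (K y)) (ε : ℝ) (x : E) :
    inner ℝ (shiftSq K ε x) x = ε * ‖x‖ ^ 2 + ‖K x‖ ^ 2 := by
  simp [shiftSq, inner_sub_left, inner_smul_left, hK (K x) x]

lemma commute_shiftSq (ε : ℝ) : Commute K (shiftSq K ε) :=
  ((Commute.one_right K).smul_right ε).sub_right ((Commute.refl K).mul_right (Commute.refl K))

/-- The resolvent `(ε - K²)⁻¹`. -/
def resolventSq (K : E →L[ℝ] E) (ε : ℝ) : E →L[ℝ] E := Ring.inverse (shiftSq K ε)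

/-- The bounded skew-symmetric approximation `-(ε - K²)⁻¹ K` of `K⁻¹`. -/
def yosida (K : E →L[ℝ] E) (ε : ℝ) : E →L[ℝ] E := -(resolventSq K ε * K)

lemma commute_resolventSq (ε : ℝ) : Commute K (resolventSq K ε) := by
  by_cases h : IsUnit (shiftSq K ε)
  · obtain ⟨a, ha⟩ := h
    have h1 := commute_shiftSq (K := K) ε
    rw [resolventSq, ← ha, Ring.inverse_unit]
    rw [← ha] at h1
    exact h1.units_inv_right
  · rw [resolventSq, Ring.inverse_non_unit _ h]
    exact Commute.zero_right K

lemma commute_yosida_right (ε : ℝ) : Commute K (yosida K ε) :=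
  ((commute_resolventSq ε).mul_right (Commute.refl K)).neg_right

lemma commute_yosida_yosida (ε δ : ℝ) : Commute (yosida K ε) (yosida K δ) := by
  have h1 : Commute (shiftSq K ε) (shiftSq K δ) :=
    ((Commute.one_left _).smul_left ε).sub_left ((commute_shiftSq δ).mul_left (commute_shiftSq δ))
  have h2 : Commute (resolventSq K ε) (resolventSq K δ) := h1.ringInverse_ringInverse
  exact ((h2.mul_left (commute_resolventSq δ)).mul_right
    (((commute_resolventSq ε).symm).mul_left (Commute.refl K))).neg_left.neg_right

/-- Strong convergence of equicontinuous linear maps propagates from a dense set. -/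
lemma tendsto_of_denseRange {ι X : Type*} {l : Filter ι} {A : ι → E →L[ℝ] E} {B : E →L[ℝ] E}
    {C : ℝ} (hA : ∀ i x, ‖A i x‖ ≤ C * ‖x‖) (hB : ∀ x, ‖B x‖ ≤ C * ‖x‖) {e : X → E}
    (he : DenseRange e) (h : ∀ a, Tendsto (fun i => A i (e a)) l (𝓝 (B (e a)))) (x : E) :
    Tendsto (fun i => A i x) l (𝓝 (B x)) := by
  rw [Metric.tendsto_nhds]
  intro η hη
  have hC : 0 < |C| + 1 := by positivity
  obtain ⟨a, ha⟩ := he.exists_dist_lt x (ε := η / (3 * (|C| + 1))) (by positivity)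
  filter_upwards [Metric.tendsto_nhds.1 (h a) (η / 3) (by positivity)] with i hi
  have hd : (|C| + 1) * ‖x - e a‖ ≤ η / 3 := by
    rw [dist_eq_norm] at ha
    calc (|C| + 1) * ‖x - e a‖ ≤ (|C| + 1) * (η / (3 * (|C| + 1))) := by gcongr
      _ = η / 3 := by field_simp
  have hCC : C ≤ |C| + 1 := (le_abs_self C).trans (by linarith)
  have h1 : ‖A i (x - e a)‖ ≤ η / 3 := (hA _ _).trans ((by gcongr : _ ≤ _).trans hd)
  have h2 : ‖B (x - e a)‖ ≤ η / 3 := (hB _).trans ((by gcongr : _ ≤ _).trans hd)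
  rw [dist_eq_norm] at hi ⊢
  have e1 : A i x - B x = A i (x - e a) + (A i (e a) - B (e a)) - B (x - e a) := by
    simp only [map_sub]; abel
  rw [e1]
  have h3 := norm_sub_le (A i (x - e a) + (A i (e a) - B (e a))) (B (x - e a))
  have h4 := norm_add_le (A i (x - e a)) (A i (e a) - B (e a))
  linarith

variable [CompleteSpace E]

lemma hasDerivAt_exp_smul_apply (C : E →L[ℝ] E) (x : E) (t : ℝ) :
    HasDerivAt (fun τ : ℝ => exp (τ • C) x) (exp (t • C) (C x)) t :=
  by
  simpa using (hasDerivAt_exp_smul_const (𝕂 := ℝ) C t).clm_apply (hasDerivAt_const t x)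

/-- The exponential of a skew-symmetric operator is an isometry. -/
lemma norm_exp_smul_apply {C : E →L[ℝ] E} (hC : ∀ x, inner ℝ (C x) x = 0) (t : ℝ) (x : E) :
    ‖exp (t • C) x‖ = ‖x‖ := by
  have h : ∀ τ : ℝ, HasDerivAt (fun τ : ℝ => ‖exp (τ • C) x‖ ^ 2) 0 τ := by
    intro τ
    have h1 := (hasDerivAt_exp_smul_apply C x τ).norm_sq
    rw [exp_smul_comm_apply (Commute.refl C), real_inner_comm, hC, mul_zero] at h1
    exact h1
  have h2 := is_const_of_deriv_eq_zero (fun τ => (h τ).differentiableAt) (fun τ => (h τ).deriv) t 0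
  simp only [zero_smul, exp_zero, one_apply_eq_self] at h2
  exact (sq_eq_sq₀ (norm_nonneg _) (norm_nonneg _)).1 h2

lemma norm_exp_smul_apply_sub_le {C : E →L[ℝ] E} (hC : ∀ x, inner ℝ (C x) x = 0) (t : ℝ) (x : E) :
    ‖exp (t • C) x - x‖ ≤ |t| * ‖C x‖ := by
  have := convex_univ.norm_image_sub_le_of_norm_hasDerivWithin_le (f := fun τ : ℝ => exp (τ • C) x)
    (fun τ _ => (hasDerivAt_exp_smul_apply C x τ).hasDerivWithinAt)
    (fun τ _ => (norm_exp_smul_apply hC τ (C x)).le) (mem_univ 0) (mem_univ t)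
  simpa [mul_comm] using this

/-- As `exp(tC) = exp(tD) exp(t(C - D))` and the first factor is an isometry, the difference of two
commuting groups is controlled by the difference of their generators. -/
lemma norm_exp_smul_apply_sub_exp_smul_apply_le {C D : E →L[ℝ] E} (h : Commute C D)
    (hC : ∀ x, inner ℝ (C x) x = 0) (hD : ∀ x, inner ℝ (D x) x = 0) (t : ℝ) (x : E) :
    ‖exp (t • C) x - exp (t • D) x‖ ≤ |t| * ‖C x - D x‖ := by
  have h1 : exp (t • C) = exp (t • D) * exp (t • (C - D)) := by
    let _ : NormedAlgebra ℚ (E →L[ℝ] E) := NormedAlgebra.restrictScalars ℚ ℝ (E →L[ℝ] E)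
    rw [← exp_add_of_commute, ← smul_add, add_sub_cancel]
    exact ((h.symm.sub_right (Commute.refl D)).smul_left t).smul_right t
  rw [h1, mul_apply_eq_comp, ← map_sub, norm_exp_smul_apply hD]
  exact norm_exp_smul_apply_sub_le (fun x => by simp [inner_sub_left, hC, hD]) t x

/-- A skew-symmetric injective operator has dense range. -/
lemma denseRange_of_skew (hK : ∀ x y, inner ℝ (K x) y = -inner ℝ x (K y))
    (hinj : ∀ x, K x = 0 → x = 0) : DenseRange K := by
  have h : (LinearMap.range (K : E →ₗ[ℝ] E))ᗮ = ⊥ := by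
    rw [Submodule.eq_bot_iff]
    intro x hx
    refine hinj x (inner_self_eq_zero (𝕜 := ℝ).1 ?_)
    have h1 := (Submodule.mem_orthogonal _ _).1 hx (K (K x)) ⟨K x, rfl⟩
    rw [hK] at h1
    linarith
  have := (Submodule.dense_iff_topologicalClosure_eq_top).2
    ((Submodule.topologicalClosure_eq_top_iff).2 h)
  exact this

lemma isUnit_shiftSq (hK : ∀ x y, inner ℝ (K x) y = -inner ℝ x (K y)) {ε : ℝ} (hε : 0 < ε) :
    IsUnit (shiftSq K ε) := by
  refine ContinuousLinearMap.isUnit_of_forall_le_norm_inner_map _ (c := ⟨ε, hε.le⟩) hε fun x => ?_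
  rw [inner_shiftSq hK]
  refine le_trans ?_ (le_abs_self _)
  change ‖x‖ ^ 2 * ε ≤ _
  nlinarith [sq_nonneg ‖K x‖]

lemma shiftSq_resolventSq (hK : ∀ x y, inner ℝ (K x) y = -inner ℝ x (K y)) {ε : ℝ} (hε : 0 < ε)
    (x : E) : shiftSq K ε (resolventSq K ε x) = x :=
  DFunLike.congr_fun (Ring.mul_inverse_cancel _ (isUnit_shiftSq hK hε)) x

lemma resolventSq_shiftSq (hK : ∀ x y, inner ℝ (K x) y = -inner ℝ x (K y)) {ε : ℝ} (hε : 0 < ε)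
    (x : E) : resolventSq K ε (shiftSq K ε x) = x :=
  DFunLike.congr_fun (Ring.inverse_mul_cancel _ (isUnit_shiftSq hK hε)) x

/-- The approximations are skew-symmetric: for `x = (ε - K²) z` the approximation maps `x` to
`-K z`, which is orthogonal to `z` and to `K² z`. -/
lemma inner_yosida_self (hK : ∀ x y, inner ℝ (K x) y = -inner ℝ x (K y)) {ε : ℝ} (hε : 0 < ε)
    (x : E) : inner ℝ (yosida K ε x) x = 0 := by
  obtain ⟨z, rfl⟩ : ∃ z, shiftSq K ε z = x := ⟨_, shiftSq_resolventSq hK hε x⟩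
  have h1 : yosida K ε (shiftSq K ε z) = -K z := by
    have h2 : K (shiftSq K ε z) = shiftSq K ε (K z) := DFunLike.congr_fun (commute_shiftSq ε).eq z
    simp [yosida, h2, resolventSq_shiftSq hK hε]
  rw [h1]
  simp [shiftSq, inner_sub_right, inner_smul_right, inner_apply_self_of_skew hK,
    real_inner_comm (K (K z)) (K z)]

lemma norm_smul_resolventSq_le (hK : ∀ x y, inner ℝ (K x) y = -inner ℝ x (K y)) {ε : ℝ}
    (hε : 0 < ε) (x : E) : ‖ε • resolventSq K ε x‖ ≤ ‖x‖ := by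
  set p := resolventSq K ε x
  have h1 := inner_shiftSq hK ε p
  rw [shiftSq_resolventSq hK hε] at h1
  have h2 := real_inner_le_norm x p
  rw [norm_smul, Real.norm_of_nonneg hε.le]
  rcases (norm_nonneg p).eq_or_lt with h | h
  · rw [← h]; simp
  · refine le_of_mul_le_mul_right ?_ h
    nlinarith [sq_nonneg ‖K p‖]

lemma yosida_apply (hK : ∀ x y, inner ℝ (K x) y = -inner ℝ x (K y)) {ε : ℝ} (hε : 0 < ε)
    (y : E) : yosida K ε (K y) = y - ε • resolventSq K ε y := by
  have h := resolventSq_shiftSq hK hε y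
  simp only [shiftSq, sub_apply, smul_apply,
    one_apply_eq_self, mul_apply_eq_comp, map_sub, map_smul] at h
  simp only [yosida, neg_apply, mul_apply_eq_comp]
  nth_rewrite 2 [← h]
  abel

/-- The parameters `1/(n+1)` of the approximating sequence. -/
def epsSeq (n : ℕ) : ℝ := 1 / ((n : ℝ) + 1)

lemma epsSeq_pos (n : ℕ) : 0 < epsSeq n := by unfold epsSeq; positivity

lemma tendsto_epsSeq : Tendsto epsSeq atTop (𝓝 0) := tendsto_one_div_add_atTop_nhds_zero_nat

/-- `ε (ε - K²)⁻¹` is a contraction and is of order `ε` on the range of `K²`, so it tends strongly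
to `0`. -/
lemma tendsto_smul_resolventSq (hK : ∀ x y, inner ℝ (K x) y = -inner ℝ x (K y))
    (hinj : ∀ x, K x = 0 → x = 0) (y : E) :
    Tendsto (fun n => epsSeq n • resolventSq K (epsSeq n) y) atTop (𝓝 0) := by
  have hd := denseRange_of_skew hK hinj
  have := tendsto_of_denseRange (l := atTop) (A := fun n => epsSeq n • resolventSq K (epsSeq n))
    (B := 0) (C := 1) (fun n x => by
      simpa using norm_smul_resolventSq_le hK (epsSeq_pos n) x) (fun x => by simp)
    (hd.comp hd K.continuous) ?_ y
  · simpa using this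
  · intro z
    rw [zero_apply]
    refine squeeze_zero_norm (a := fun n => epsSeq n * (2 * ‖z‖)) (fun n => ?_)
      (by simpa using tendsto_epsSeq.mul_const (2 * ‖z‖))
    have h1 := yosida_apply hK (epsSeq_pos n) z
    have h2 : resolventSq K (epsSeq n) (K (K z)) = epsSeq n • resolventSq K (epsSeq n) z - z := by
      rw [← neg_inj]
      simpa [yosida] using h1
    have h3 : ‖epsSeq n • resolventSq K (epsSeq n) z - z‖ ≤ 2 * ‖z‖ :=
      (norm_sub_le _ _).trans (by linarith [norm_smul_resolventSq_le hK (epsSeq_pos n) z])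
    simp only [smul_apply, Function.comp_apply]
    rw [h2, norm_smul, Real.norm_of_nonneg (epsSeq_pos n).le]
    exact mul_le_mul_of_nonneg_left h3 (epsSeq_pos n).le

/-- On the range of `K` the approximations converge to `K⁻¹`. -/
lemma tendsto_yosida (hK : ∀ x y, inner ℝ (K x) y = -inner ℝ x (K y))
    (hinj : ∀ x, K x = 0 → x = 0) (y : E) :
    Tendsto (fun n => yosida K (epsSeq n) (K y)) atTop (𝓝 y) := by
  have := (tendsto_smul_resolventSq hK hinj y).const_sub y
  simpa [yosida_apply hK (epsSeq_pos _)] using this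

/-- The approximating groups of isometries. -/
def yosidaExp (K : E →L[ℝ] E) (n : ℕ) (t : ℝ) : E →L[ℝ] E := exp (t • yosida K (epsSeq n))

lemma cauchySeq_yosidaExp (hK : ∀ x y, inner ℝ (K x) y = -inner ℝ x (K y))
    (hinj : ∀ x, K x = 0 → x = 0) (t : ℝ) (x : E) :
    CauchySeq fun n => yosidaExp K n t x := by
  have hsk := fun n => inner_yosida_self hK (epsSeq_pos n)
  rw [Metric.cauchySeq_iff]
  intro η hη
  obtain ⟨y, hy⟩ := (denseRange_of_skew hK hinj).exists_dist_lt x (ε := η / 3) (by positivity)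
  have hη' : 0 < η / (3 * (|t| + 1)) := by positivity
  obtain ⟨n₀, hn₀⟩ := Metric.cauchySeq_iff.1 (tendsto_yosida hK hinj y).cauchySeq _ hη'
  refine ⟨n₀, fun p hp q hq => ?_⟩
  have h1 := hn₀ p hp q hq
  rw [dist_eq_norm] at h1 hy ⊢
  have h2 := norm_exp_smul_apply_sub_exp_smul_apply_le
    (commute_yosida_yosida (K := K) (epsSeq p) (epsSeq q)) (hsk p) (hsk q) t (K y)
  have h3 : |t| * ‖yosida K (epsSeq p) (K y) - yosida K (epsSeq q) (K y)‖ ≤ η / 3 := by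
    calc _ ≤ (|t| + 1) * (η / (3 * (|t| + 1))) := by gcongr; linarith
      _ = η / 3 := by field_simp
  have h4 : ∀ n, ‖yosidaExp K n t (x - K y)‖ < η / 3 := fun n => by
    rw [yosidaExp, norm_exp_smul_apply (hsk n)]; exact hy
  have e1 : yosidaExp K p t x - yosidaExp K q t x = yosidaExp K p t (x - K y)
      + (yosidaExp K p t (K y) - yosidaExp K q t (K y)) - yosidaExp K q t (x - K y) := by
    simp only [map_sub]; abel
  rw [e1]
  have h5 := norm_sub_le (yosidaExp K p t (x - K y)
      + (yosidaExp K p t (K y) - yosidaExp K q t (K y))) (yosidaExp K q t (x - K y))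
  have h6 := norm_add_le (yosidaExp K p t (x - K y))
      (yosidaExp K p t (K y) - yosidaExp K q t (K y))
  have h7 : ‖yosidaExp K p t (K y) - yosidaExp K q t (K y)‖ ≤ η / 3 := h2.trans h3
  linarith [h4 p, h4 q]

/-- **Stone's theorem** for an operator with bounded inverse: a bounded injective skew-symmetric
operator `K` is the inverse of the generator of a strongly continuous group of isometries. -/
theorem exists_isUnitaryGroup (hK : ∀ x y, inner ℝ (K x) y = -inner ℝ x (K y))
    (hinj : ∀ x, K x = 0 → x = 0) : ∃ S : ℝ → E →L[ℝ] E, IsUnitaryGroup S K := by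
  have hsk := fun n => inner_yosida_self hK (epsSeq_pos n)
  have hlim : ∀ t x, ∃ y, Tendsto (fun n => yosidaExp K n t x) atTop (𝓝 y) := fun t x =>
    cauchySeq_tendsto_of_complete (cauchySeq_yosidaExp hK hinj t x)
  choose g hg using hlim
  let S : ℝ → E →L[ℝ] E := fun t => continuousLinearMapOfTendsto (fun n => yosidaExp K n t)
    (f := g t) (tendsto_pi_nhds.2 (hg t))
  have hS : ∀ t x, Tendsto (fun n => yosidaExp K n t x) atTop (𝓝 (S t x)) := hg
  have hnorm_n : ∀ n t x, ‖yosidaExp K n t x‖ = ‖x‖ := fun n t x => norm_exp_smul_apply (hsk n) t x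
  have hnorm : ∀ t x, ‖S t x‖ = ‖x‖ := fun t x =>
    tendsto_nhds_unique (hS t x).norm (by simp [hnorm_n])
  have hzero : S 0 = ContinuousLinearMap.id ℝ E := by
    ext x
    exact tendsto_nhds_unique (hS 0 x) (by simp [yosidaExp])
  have hadd : ∀ t r, S (t + r) = (S t).comp (S r) := by
    intro t r
    ext x
    refine tendsto_nhds_unique (hS (t + r) x) ?_
    have h1 : ∀ n, yosidaExp K n (t + r) x = yosidaExp K n t (yosidaExp K n r x - S r x)
        + yosidaExp K n t (S r x) := by
      intro n
      rw [← map_add, sub_add_cancel, yosidaExp, add_smul]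
      let _ : NormedAlgebra ℚ (E →L[ℝ] E) := NormedAlgebra.restrictScalars ℚ ℝ (E →L[ℝ] E)
      rw [exp_add_of_commute (((Commute.refl _).smul_left t).smul_right r)]
      rfl
    simp only [h1]
    have h2 : Tendsto (fun n => yosidaExp K n t (yosidaExp K n r x - S r x)) atTop (𝓝 0) := by
      rw [tendsto_zero_iff_norm_tendsto_zero]
      simp only [hnorm_n]
      exact tendsto_iff_norm_sub_tendsto_zero.1 (hS r x)
    simpa using h2.add (hS t (S r x))
  have hcomm : ∀ t x, S t (K x) = K (S t x) := by
    intro t x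
    refine tendsto_nhds_unique (hS t (K x)) ?_
    have := (K.continuous.tendsto _).comp (hS t x)
    refine this.congr fun n => ?_
    exact (exp_smul_comm_apply (commute_yosida_right (K := K) (epsSeq n)).symm x t).symm
  -- `S` is Lipschitz in time on the range of `K`, hence strongly continuous by density.
  have hlip : ∀ t y, ‖S t (K y) - K y‖ ≤ |t| * ‖y‖ := by
    intro t y
    refine le_of_tendsto_of_tendsto ((hS t (K y)).sub_const (K y)).norm
      ((tendsto_yosida hK hinj y).norm.const_mul |t|) (Eventually.of_forall fun n => ?_)
    exact norm_exp_smul_apply_sub_le (hsk n) t (K y)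
  have hcont0 : ∀ x, Tendsto (fun t => S t x) (𝓝 0) (𝓝 x) := by
    intro x
    refine tendsto_of_denseRange (B := ContinuousLinearMap.id ℝ E) (C := 1)
      (fun t x => by simp [hnorm]) (fun x => by simp) (denseRange_of_skew hK hinj) (fun y => ?_) x
    rw [tendsto_iff_norm_sub_tendsto_zero]
    refine squeeze_zero (fun _ => norm_nonneg _) (fun t => hlip t y) ?_
    have : Tendsto (fun t : ℝ => |t| * ‖y‖) (𝓝 0) (𝓝 (|0| * ‖y‖)) :=
      (continuous_abs.tendsto 0).mul_const _
    simpa using this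
  have hcont : ∀ x, Continuous fun t => S t x := by
    intro x
    rw [continuous_iff_continuousAt]
    intro t
    have h1 : (fun r => S r x) = fun r => S t (S (r - t) x) := by
      ext r
      rw [← ContinuousLinearMap.comp_apply, ← hadd, add_sub_cancel]
    have h2 : Tendsto (fun r => r - t) (𝓝 t) (𝓝 0) := by
      have : Tendsto (fun r => r - t) (𝓝 t) (𝓝 (t - t)) := tendsto_id.sub_const t
      simpa using this
    unfold ContinuousAt
    rw [h1]
    have h3 := ((S t).continuous.tendsto x).comp ((hcont0 x).comp h2)
    simpa [hzero, Function.comp_def] using h3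
  refine ⟨S, hzero, hadd, hnorm, hcont, hcomm, fun y t => ?_⟩
  -- The integrated form of the evolution equation passes to the limit by dominated convergence.
  have hint : ∀ t, S t (K y) = K y + ∫ τ in (0 : ℝ)..t, S τ y := by
    intro t
    have h1 : ∀ n, yosidaExp K n t (K y)
        = K y + ∫ τ in (0 : ℝ)..t, yosidaExp K n τ (yosida K (epsSeq n) (K y)) := by
      intro n
      have hd := fun τ => hasDerivAt_exp_smul_apply (yosida K (epsSeq n)) (K y) τ
      have hd' := fun τ => hasDerivAt_exp_smul_apply (yosida K (epsSeq n))
        (yosida K (epsSeq n) (K y)) τ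
      have hc : Continuous fun τ => yosidaExp K n τ (yosida K (epsSeq n) (K y)) :=
        continuous_iff_continuousAt.2 fun τ => (hd' τ).continuousAt
      have := intervalIntegral.integral_eq_sub_of_hasDerivAt (fun τ _ => hd τ)
        (hc.intervalIntegrable 0 t)
      rw [yosidaExp]
      simp only [yosidaExp]
      rw [this]
      simp
    refine tendsto_nhds_unique (hS t (K y)) ?_
    simp only [h1]
    refine tendsto_const_nhds.add ?_
    obtain ⟨M, hM⟩ := (tendsto_yosida hK hinj y).norm.bddAbove_range
    refine intervalIntegral.tendsto_integral_filter_of_dominated_convergence (fun _ => M) ?_ ?_ ?_ ?_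
    · refine Eventually.of_forall fun n => Continuous.aestronglyMeasurable ?_
      exact continuous_iff_continuousAt.2 fun τ =>
        (hasDerivAt_exp_smul_apply (yosida K (epsSeq n)) _ τ).continuousAt
    · refine Eventually.of_forall fun n => Eventually.of_forall fun τ _ => ?_
      rw [hnorm_n]
      exact hM ⟨n, rfl⟩
    · exact intervalIntegrable_const
    · refine Eventually.of_forall fun τ _ => ?_
      have h2 : Tendsto (fun n => yosidaExp K n τ (yosida K (epsSeq n) (K y) - y)) atTop (𝓝 0) := by
        rw [tendsto_zero_iff_norm_tendsto_zero]
        simp only [hnorm_n]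
        exact tendsto_iff_norm_sub_tendsto_zero.1 (tendsto_yosida hK hinj y)
      simpa using h2.add (hS τ y)
  have h2 := (intervalIntegral.integral_hasDerivAt_right ((hcont y).intervalIntegrable 0 t)
    ((hcont y).stronglyMeasurableAtFilter _ _) (hcont y).continuousAt).const_add (K y)
  exact h2.congr_of_eventuallyEq (Eventually.of_forall hint)

end UnitaryGroup

/-! ### Maximal solutions of ordinary differential equations in Banach spaces -/

section MaximalSolution

variable {E : Type*} [NormedAddCommGroup E]

/-- A time-dependent vector field which is continuous in time and Lipschitz on bounded sets,
uniformly for bounded times. -/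
structure IsLipschitzField (G : ℝ → E → E) : Prop where
  continuous : ∀ x, Continuous fun t => G t x
  lipschitz : ∀ a b R : ℝ, ∃ K : ℝ≥0, ∀ t ∈ Icc a b, LipschitzOnWith K (G t) (Metric.closedBall 0 R)

lemma IsLipschitzField.continuous_uncurry {G : ℝ → E → E} (hG : IsLipschitzField G) :
    Continuous fun p : ℝ × E => G p.1 p.2 := by
  rw [continuous_iff_continuousAt]
  rintro ⟨t, x⟩
  obtain ⟨K, hK⟩ := hG.lipschitz (t - 1) (t + 1) (‖x‖ + 1)
  have h := continuousOn_prod_of_continuousOn_lipschitzOnWith' (fun p : ℝ × E => G p.1 p.2) K hK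
    (fun y _ => (hG.continuous y).continuousOn)
  refine h.continuousAt (prod_mem_nhds (Icc_mem_nhds (by linarith) (by linarith)) ?_)
  refine mem_of_superset (Metric.closedBall_mem_nhds x one_pos) ?_
  exact Metric.closedBall_subset_closedBall' (by rw [dist_zero_right]; linarith)

lemma isOpen_coe_lt (T : EReal) : IsOpen {t : ℝ | (t : EReal) < T} :=
  isOpen_Iio.preimage continuous_coe_real_ereal

lemma isOpen_timeIoo (s : ℝ) (T : EReal) : IsOpen (timeIoo s T) :=
  isOpen_Ioi.inter (isOpen_coe_lt T)

lemma timeIoo_subset_timeIco (s : ℝ) (T : EReal) : timeIoo s T ⊆ timeIco s T :=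
  fun _ h => ⟨h.1.le, h.2⟩

lemma Icc_subset_timeIco {s t : ℝ} {T : EReal} (ht : t ∈ timeIco s T) : Icc s t ⊆ timeIco s T :=
  fun _ h => ⟨h.1, (EReal.coe_le_coe_iff.2 h.2).trans_lt ht.2⟩

lemma timeIco_mono {s : ℝ} {T T' : EReal} (h : T ≤ T') : timeIco s T ⊆ timeIco s T' :=
  fun _ ht => ⟨ht.1, ht.2.trans_le h⟩

variable [NormedSpace ℝ E]

/-- A solution on `[s, T)` of `z' = G(t, z)`, `z(s) = z₀`, in integrated form. -/
structure IsIntegralSolution (G : ℝ → E → E) (s : ℝ) (T : EReal) (z₀ : E) (z : ℝ → E) : Prop where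
  continuousOn : ContinuousOn z (timeIco s T)
  eq_integral : ∀ t ∈ timeIco s T, z t = z₀ + ∫ τ in s..t, G τ (z τ)

namespace IsIntegralSolution

variable {G : ℝ → E → E} {s : ℝ} {T : EReal} {z₀ : E} {z : ℝ → E}

lemma mono {T' : EReal} (h : IsIntegralSolution G s T z₀ z) (hT : T' ≤ T) :
    IsIntegralSolution G s T' z₀ z :=
  ⟨h.continuousOn.mono (timeIco_mono hT), fun t ht => h.eq_integral t (timeIco_mono hT ht)⟩

lemma initial (h : IsIntegralSolution G s T z₀ z) (hsT : (s : EReal) < T) : z s = z₀ := by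
  simpa using h.eq_integral s ⟨le_rfl, hsT⟩

lemma continuousOn_field (h : IsIntegralSolution G s T z₀ z) (hG : IsLipschitzField G) :
    ContinuousOn (fun t => G t (z t)) (timeIco s T) :=
  hG.continuous_uncurry.comp_continuousOn (continuousOn_id.prodMk h.continuousOn)

/-- Being a solution is a local property: solutions on shorter intervals can be glued. -/
lemma congr_of_forall_exists {y : ℝ → E}
    (h : ∀ t ∈ timeIco s T, ∃ T' : EReal, (t : EReal) < T' ∧ ∃ z, IsIntegralSolution G s T' z₀ z ∧
      EqOn y z (timeIco s T')) : IsIntegralSolution G s T z₀ y := by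
  refine ⟨fun t ht => ?_, fun t ht => ?_⟩
  · obtain ⟨T', htT', z, hz, he⟩ := h t ht
    have h1 : timeIco s T' ∈ 𝓝[timeIco s T] t := by
      filter_upwards [self_mem_nhdsWithin,
        mem_nhdsWithin_of_mem_nhds ((isOpen_coe_lt T').mem_nhds htT')] with τ h1 h2
      exact ⟨h1.1, h2⟩
    have h2 : ContinuousWithinAt z (timeIco s T) t :=
      (hz.continuousOn t ⟨ht.1, htT'⟩).mono_of_mem_nhdsWithin h1
    refine h2.congr_of_eventuallyEq ?_ (he ⟨ht.1, htT'⟩)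
    filter_upwards [h1] with τ hτ using he hτ
  · obtain ⟨T', htT', z, hz, he⟩ := h t ht
    have ht' : t ∈ timeIco s T' := ⟨ht.1, htT'⟩
    rw [he ht', hz.eq_integral t ht']
    congr 1
    refine intervalIntegral.integral_congr fun τ hτ => ?_
    rw [uIcc_of_le ht.1] at hτ
    simp only [he (Icc_subset_timeIco ht' hτ)]

/-- A solution can be continued past a time `t₀` by a local solution starting at `t₀`. -/
lemma extend {α : ℝ → E}
    (hG : IsLipschitzField G) (hz : IsIntegralSolution G s T z₀ z) {t₀ δ : ℝ}
    (ht₀ : t₀ ∈ timeIco s T) (hα : ContinuousOn α (Icc t₀ (t₀ + δ)))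
    (hαi : ∀ t ∈ Icc t₀ (t₀ + δ), α t = z t₀ + ∫ τ in t₀..t, G τ (α τ)) (hδ : 0 < δ) :
    ∃ y, IsIntegralSolution G s ((t₀ + δ : ℝ) : EReal) z₀ y := by
  classical
  have hα0 : α t₀ = z t₀ := by simpa using hαi t₀ (left_mem_Icc.2 (by linarith))
  let y : ℝ → E := fun t => if t ≤ t₀ then z t else α t
  have hyz : ∀ t ≤ t₀, y t = z t := fun t ht => if_pos ht
  have hyα : ∀ t ≥ t₀, y t = α t := by
    intro t ht
    rcases ht.eq_or_lt with rfl | h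
    · rw [hyz _ le_rfl, hα0]
    · exact if_neg (not_le.2 h)
  have hyc1 : ContinuousOn y (Icc s t₀) :=
    (hz.continuousOn.mono (Icc_subset_timeIco ht₀)).congr fun t ht => hyz t ht.2
  have hyc2 : ContinuousOn y (Icc t₀ (t₀ + δ)) := hα.congr fun t ht => hyα t ht.1
  have hyc : ContinuousOn y (Icc s (t₀ + δ)) := by
    rw [← Icc_union_Icc_eq_Icc ht₀.1 (by linarith : t₀ ≤ t₀ + δ)]
    exact hyc1.union_of_isClosed hyc2 isClosed_Icc isClosed_Icc
  have hG1 : ContinuousOn (fun τ => G τ (y τ)) (Icc s (t₀ + δ)) :=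
    hG.continuous_uncurry.comp_continuousOn (continuousOn_id.prodMk hyc)
  have hint1 : ∀ t ∈ Icc s t₀, y t = z₀ + ∫ τ in s..t, G τ (y τ) := by
    intro t ht
    rw [hyz t ht.2, hz.eq_integral t (Icc_subset_timeIco ht₀ ht)]
    congr 1
    refine intervalIntegral.integral_congr fun τ hτ => ?_
    rw [uIcc_of_le ht.1] at hτ
    simp only [hyz τ (hτ.2.trans ht.2)]
  refine ⟨y, hyc.mono fun t ht => ⟨ht.1, (EReal.coe_lt_coe_iff.1 ht.2).le⟩, fun t ht => ?_⟩
  have ht2 : t ≤ t₀ + δ := (EReal.coe_lt_coe_iff.1 ht.2).le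
  rcases le_total t t₀ with h | h
  · exact hint1 t ⟨ht.1, h⟩
  · have h1 : ∫ τ in t₀..t, G τ (α τ) = ∫ τ in t₀..t, G τ (y τ) := by
      refine intervalIntegral.integral_congr fun τ hτ => ?_
      rw [uIcc_of_le h] at hτ
      simp only [hyα τ hτ.1]
    rw [hyα t h, hαi t ⟨h, ht2⟩, h1, ← hyz t₀ le_rfl, hint1 t₀ (right_mem_Icc.2 ht₀.1), add_assoc,
      intervalIntegral.integral_add_adjacent_intervals]
    · refine (hG1.mono ?_).intervalIntegrable
      rw [uIcc_of_le ht₀.1]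
      exact Icc_subset_Icc_right (by linarith)
    · refine (hG1.mono ?_).intervalIntegrable
      rw [uIcc_of_le h]
      exact Icc_subset_Icc ht₀.1 ht2

variable [CompleteSpace E]

lemma hasDerivWithinAt (h : IsIntegralSolution G s T z₀ z) (hG : IsLipschitzField G) {t : ℝ}
    (ht : t ∈ timeIco s T) : HasDerivWithinAt z (G t (z t)) (Ici t) t := by
  have hc := h.continuousOn_field hG
  obtain ⟨b, htb, hbT⟩ := EReal.lt_iff_exists_real_btwn.1 ht.2
  have hb : b ∈ timeIco s T := ⟨ht.1.trans (EReal.coe_lt_coe_iff.1 htb).le, hbT⟩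
  have htb' : t < b := EReal.coe_lt_coe_iff.1 htb
  have hsub : Icc s b ⊆ timeIco s T := Icc_subset_timeIco hb
  have hI : Icc t b ∈ 𝓝[≥] t := Icc_mem_nhdsGE htb'
  have hct : ContinuousWithinAt (fun t => G t (z t)) (Icc t b) t :=
    (hc t ht).mono ((Icc_subset_Icc_left ht.1).trans hsub)
  have hFTC : HasDerivWithinAt (fun r => ∫ τ in s..r, G τ (z τ)) (G t (z t)) (Ici t) t := by
    refine intervalIntegral.integral_hasDerivWithinAt_right (t := Ioi t) ?_ ?_ ?_
    · refine ContinuousOn.intervalIntegrable ?_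
      rw [uIcc_of_le ht.1]
      exact hc.mono (Icc_subset_timeIco ht)
    · refine ⟨Ioo t b, Ioo_mem_nhdsGT htb', ?_⟩
      exact (hc.mono ((Ioo_subset_Icc_self.trans (Icc_subset_Icc_left ht.1)).trans
        hsub)).aestronglyMeasurable measurableSet_Ioo
    · exact (hct.mono_of_mem_nhdsWithin hI).mono Ioi_subset_Ici_self
  refine (hFTC.const_add z₀).congr_of_eventuallyEq ?_ (h.eq_integral t ht)
  filter_upwards [hI] with r hr
  exact h.eq_integral r (hsub ⟨ht.1.trans hr.1, hr.2⟩)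

lemma hasDerivAt (h : IsIntegralSolution G s T z₀ z) (hG : IsLipschitzField G) {t : ℝ}
    (ht : t ∈ timeIoo s T) : HasDerivAt z (G t (z t)) t := by
  have hc := (h.continuousOn_field hG).mono (timeIoo_subset_timeIco s T)
  have hn := (isOpen_timeIoo s T).mem_nhds ht
  have ht' := timeIoo_subset_timeIco s T ht
  have hFTC : HasDerivAt (fun r => ∫ τ in s..r, G τ (z τ)) (G t (z t)) t := by
    refine intervalIntegral.integral_hasDerivAt_right ?_ ?_ (hc.continuousAt hn)
    · refine ContinuousOn.intervalIntegrable ?_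
      rw [uIcc_of_le ht'.1]
      exact (h.continuousOn_field hG).mono (Icc_subset_timeIco ht')
    · exact hc.stronglyMeasurableAtFilter (isOpen_timeIoo s T) t ht
  refine (hFTC.const_add z₀).congr_of_eventuallyEq ?_
  filter_upwards [hn] with r hr
  exact h.eq_integral r (timeIoo_subset_timeIco s T hr)

/-- Solutions with the same initial value coincide on the smaller of their intervals. -/
lemma eqOn {y : ℝ → E} (hz : IsIntegralSolution G s T z₀ z) (hy : IsIntegralSolution G s T z₀ y)
    (hG : IsLipschitzField G) : EqOn z y (timeIco s T) := by
  intro t ht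
  have hsT : (s : EReal) < T := (EReal.coe_le_coe_iff.2 ht.1).trans_lt ht.2
  have hsub := Icc_subset_timeIco ht
  have hcz := hz.continuousOn.mono hsub
  have hcy := hy.continuousOn.mono hsub
  obtain ⟨R₁, hR₁⟩ := isCompact_Icc.exists_bound_of_continuousOn hcz
  obtain ⟨R₂, hR₂⟩ := isCompact_Icc.exists_bound_of_continuousOn hcy
  obtain ⟨K, hK⟩ := hG.lipschitz s t (max R₁ R₂)
  refine ODE_solution_unique_of_mem_Icc_right (v := G)
    (s := fun _ => Metric.closedBall 0 (max R₁ R₂)) (K := K)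
    (fun τ hτ => hK τ (Ico_subset_Icc_self hτ)) hcz
    (fun τ hτ => hz.hasDerivWithinAt hG (hsub (Ico_subset_Icc_self hτ))) (fun τ hτ => ?_) hcy
    (fun τ hτ => hy.hasDerivWithinAt hG (hsub (Ico_subset_Icc_self hτ))) (fun τ hτ => ?_)
    ((hz.initial hsT).trans (hy.initial hsT).symm) (right_mem_Icc.2 ht.1)
  · simpa using Or.inl (hR₁ τ (Ico_subset_Icc_self hτ))
  · simpa using Or.inr (hR₂ τ (Ico_subset_Icc_self hτ))

end IsIntegralSolution

variable [CompleteSpace E] {G : ℝ → E → E}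

/-- The existence time of a local solution is bounded below for bounded initial times and
bounded initial values. -/
lemma IsLipschitzField.exists_local (hG : IsLipschitzField G) (a b R : ℝ) :
    ∃ δ : ℝ, 0 < δ ∧ ∀ t₀ ∈ Icc a b, ∀ x : E, ‖x‖ ≤ R → ∃ α : ℝ → E,
      ContinuousOn α (Icc t₀ (t₀ + δ)) ∧
      ∀ t ∈ Icc t₀ (t₀ + δ), α t = x + ∫ τ in t₀..t, G τ (α τ) := by
  obtain ⟨K, hK⟩ := hG.lipschitz a (b + 1) (R + 1)
  obtain ⟨C, hC⟩ := (isCompact_Icc (a := a) (b := b + 1)).exists_bound_of_continuousOn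
    (hG.continuous 0).continuousOn
  -- `M` bounds the field on the ball of radius `R + 1`, so a solution starting in the ball of
  -- radius `R` stays in the larger one for a time `1/(M+1)`
  set M : ℝ := |C| + K * |R + 1| with hM
  have hM0 : 0 ≤ M := by positivity
  have hbound : ∀ t ∈ Icc a (b + 1), ∀ y ∈ Metric.closedBall (0 : E) (R + 1), ‖G t y‖ ≤ M := by
    intro t ht y hy
    have hR : 0 ≤ R + 1 := by
      have := dist_nonneg.trans (Metric.mem_closedBall.1 hy); exact this
    have h1 := (hK t ht).norm_sub_le hy (Metric.mem_closedBall_self hR)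
    have h2 : ‖y - 0‖ ≤ |R + 1| := by
      rw [sub_zero]; exact (mem_closedBall_zero_iff.1 hy).trans (le_abs_self _)
    have h3 : (K : ℝ) * ‖y - 0‖ ≤ K * |R + 1| := by gcongr
    have h4 := (hC t ht).trans (le_abs_self C)
    have h5 := norm_add_le (G t y - G t 0) (G t 0)
    rw [sub_add_cancel] at h5
    linarith
  refine ⟨1 / (M + 1), by positivity, fun t₀ ht₀ x hx => ?_⟩
  have hδ : 0 < 1 / (M + 1) := by positivity
  have hδ1 : 1 / (M + 1) ≤ 1 := by rw [div_le_one (by positivity)]; linarith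
  have hsub : Icc t₀ (t₀ + 1 / (M + 1)) ⊆ Icc a (b + 1) :=
    Icc_subset_Icc ht₀.1 (by linarith [ht₀.2])
  have hball : Metric.closedBall x ((1 : ℝ≥0) : ℝ) ⊆ Metric.closedBall 0 (R + 1) := by
    refine Metric.closedBall_subset_closedBall' ?_
    rw [dist_zero_right, NNReal.coe_one]
    linarith
  have hPL : IsPicardLindelof G (tmin := t₀) (tmax := t₀ + 1 / (M + 1))
      ⟨t₀, left_mem_Icc.2 (by linarith)⟩ x 1 0 ⟨M, hM0⟩ K :=
    { lipschitzOnWith := fun t ht => (hK t (hsub ht)).mono hball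
      continuousOn := fun y _ => (hG.continuous y).continuousOn
      norm_le := fun t ht y hy => hbound t (hsub ht) y (hball hy)
      mul_max_le := by
        simp only [add_sub_cancel_left, sub_self, NNReal.coe_one, NNReal.coe_zero,
          sub_zero, max_eq_left hδ.le]
        change M * (1 / (M + 1)) ≤ 1
        rw [mul_one_div, div_le_one (by positivity)]
        linarith }
  obtain ⟨α, hα0, hα⟩ := hPL.exists_eq_forall_mem_Icc_hasDerivWithinAt₀
  have hcα : ContinuousOn α (Icc t₀ (t₀ + 1 / (M + 1))) := fun t ht => (hα t ht).continuousWithinAt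
  refine ⟨α, hcα, fun t ht => ?_⟩
  have hsub' : Icc t₀ t ⊆ Icc t₀ (t₀ + 1 / (M + 1)) := Icc_subset_Icc_right ht.2
  have := intervalIntegral.integral_eq_sub_of_hasDerivAt_of_le ht.1 (hcα.mono hsub')
    (fun τ hτ => (hα τ (hsub' (Ioo_subset_Icc_self hτ))).hasDerivAt
      (Icc_mem_nhds hτ.1 (hτ.2.trans_le ht.2))) (by
        refine ContinuousOn.intervalIntegrable ?_
        rw [uIcc_of_le ht.1]
        exact hG.continuous_uncurry.comp_continuousOn (continuousOn_id.prodMk (hcα.mono hsub')))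
  rw [this]
  simp only at hα0
  rw [hα0]
  abel

/-- Existence of a unique maximal solution, and the blow-up alternative. -/
theorem IsLipschitzField.exists_maximal (hG : IsLipschitzField G) (s : ℝ) (z₀ : E) :
    ∃ (T : EReal) (z : ℝ → E), (s : EReal) < T ∧ IsIntegralSolution G s T z₀ z ∧
      (∀ (T' : EReal) (y : ℝ → E), (s : EReal) < T' → IsIntegralSolution G s T' z₀ y →
        T' ≤ T ∧ EqOn y z (timeIco s T')) ∧
      (T = ⊤ ∨ ∃ T₀ : ℝ, T = T₀ ∧ limsup (fun t => ‖z t‖ₑ) (𝓝[<] T₀) = ⊤) := by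
  classical
  -- `T` is the supremum of all times up to which some solution exists; by uniqueness these
  -- solutions fit together.
  let 𝒯 : Set EReal := {T' | (s : EReal) < T' ∧ ∃ y, IsIntegralSolution G s T' z₀ y}
  let T := sSup 𝒯
  have hlt : ∀ t : ℝ, (t : EReal) < T → ∃ T' : EReal, (t : EReal) < T' ∧
      ∃ y, IsIntegralSolution G s T' z₀ y := by
    intro t ht
    obtain ⟨T', hT', htT'⟩ := lt_sSup_iff.1 ht
    exact ⟨T', htT', hT'.2⟩
  choose! τ hτ y hy using hlt
  let z : ℝ → E := fun t => y t t
  have hzy : ∀ (T' : EReal) (x : ℝ → E), T' ≤ T → IsIntegralSolution G s T' z₀ x →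
      EqOn z x (timeIco s T') := by
    intro T' x hT' hx t ht
    have htT := ht.2.trans_le hT'
    exact ((hy t htT).mono (min_le_left _ T')).eqOn (hx.mono (min_le_right _ T')) hG
      ⟨ht.1, lt_min (hτ t htT) ht.2⟩
  have hle : ∀ (T' : EReal) (x : ℝ → E), (s : EReal) < T' → IsIntegralSolution G s T' z₀ x →
      T' ≤ T := fun T' x hs hx => le_sSup ⟨hs, x, hx⟩
  have hsT : (s : EReal) < T := by
    obtain ⟨δ, hδ, h⟩ := hG.exists_local s s ‖z₀‖
    obtain ⟨α, hα, hαi⟩ := h s ⟨le_rfl, le_rfl⟩ z₀ le_rfl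
    have hs : (s : EReal) < ((s + δ : ℝ) : EReal) := EReal.coe_lt_coe_iff.2 (by linarith)
    refine hs.trans_le (hle _ α hs ⟨hα.mono fun t ht => ?_, fun t ht => hαi t ?_⟩) <;>
    exact ⟨ht.1, (EReal.coe_lt_coe_iff.1 ht.2).le⟩
  have hz : IsIntegralSolution G s T z₀ z := by
    refine IsIntegralSolution.congr_of_forall_exists fun t ht => ?_
    have hτT : τ t ≤ T := hle _ _ ((EReal.coe_le_coe_iff.2 ht.1).trans_lt (hτ t ht.2)) (hy t ht.2)
    exact ⟨τ t, hτ t ht.2, y t, hy t ht.2, hzy _ _ hτT (hy t ht.2)⟩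
  refine ⟨T, z, hsT, hz, fun T' x hs hx => ⟨hle T' x hs hx, (hzy T' x (hle T' x hs hx) hx).symm⟩, ?_⟩
  -- If `T` is finite and `‖z‖` does not blow up, local solutions starting close enough to `T`
  -- from bounded values continue `z` beyond `T`.
  by_contra! hcon
  obtain ⟨hT, hT'⟩ := hcon
  lift T to ℝ using ⟨hT, (bot_le.trans_lt hsT).ne'⟩ with T₀ hT₀
  have hsT' : s < T₀ := EReal.coe_lt_coe_iff.1 hsT
  have hlim : limsup (fun t => ‖z t‖ₑ) (𝓝[<] T₀) < ⊤ := lt_top_iff_ne_top.2 (hT' T₀ rfl)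
  obtain ⟨M, hM1, hM2⟩ := exists_between hlim
  have hev := eventually_lt_of_limsup_lt hM1
  lift M to ℝ≥0 using hM2.ne
  obtain ⟨δ, hδ, h⟩ := hG.exists_local s T₀ M
  have hev2 : ∀ᶠ t in 𝓝[<] T₀, t ∈ Ioo (max s (T₀ - δ)) T₀ :=
    Ioo_mem_nhdsLT (max_lt hsT' (by linarith))
  obtain ⟨t₀, ht₀M, ht₀⟩ := (hev.and hev2).exists
  have hst₀ : s < t₀ := (le_max_left _ _).trans_lt ht₀.1
  have hδt₀ : T₀ - δ < t₀ := (le_max_right _ _).trans_lt ht₀.1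
  have hnorm : ‖z t₀‖ ≤ M := by
    have : ‖z t₀‖₊ < M := by
      rw [enorm_eq_nnnorm] at ht₀M
      exact_mod_cast ht₀M
    exact_mod_cast this.le
  obtain ⟨α, hα, hαi⟩ := h t₀ ⟨hst₀.le, ht₀.2.le⟩ (z t₀) hnorm
  obtain ⟨x, hx⟩ := hz.extend hG ⟨hst₀.le, EReal.coe_lt_coe_iff.2 ht₀.2⟩ hα hαi hδ
  have := hle _ x (EReal.coe_lt_coe_iff.2 (by linarith)) hx
  have := EReal.coe_le_coe_iff.1 this
  linarith

end MaximalSolution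

/-! ### The embedding of `H` into `L²(Ω)` is injective with dense range -/

section Embedding

/-- The product of a function which is Lipschitz and bounded on `s` with a bounded Lipschitz
function vanishing off `s` is Lipschitz. -/
lemma exists_lipschitzWith_mul {E : Type*} [PseudoMetricSpace E] {s : Set E} {a φ : E → ℝ}
    {K D : ℝ≥0} {A M : ℝ} (ha : LipschitzOnWith K a s) (haA : ∀ x ∈ s, |a x| ≤ A)
    (hφ : LipschitzWith D φ) (hφM : ∀ x, |φ x| ≤ M) (hφ0 : ∀ x ∉ s, φ x = 0) :
    ∃ C, LipschitzWith C fun x => a x * φ x := by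
  have key : ∀ x ∈ s, ∀ y, |a x * φ x - a y * φ y| ≤ (K * |M| + |A| * D) * dist x y := by
    intro x hx y
    have h1 : |φ x - φ y| ≤ D * dist x y := by
      rw [← Real.dist_eq]; exact hφ.dist_le_mul x y
    have hA := (haA x hx).trans (le_abs_self A)
    have hM := (hφM y).trans (le_abs_self M)
    have h0 := dist_nonneg (x := x) (y := y)
    have h3 : |a x * (φ x - φ y)| ≤ |A| * (D * dist x y) := by
      rw [abs_mul]; gcongr
    by_cases hy : y ∈ s
    · have h2 : |a x - a y| ≤ K * dist x y := by
        rw [← Real.dist_eq]; exact ha.dist_le_mul x hx y hy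
      have h4 : |(a x - a y) * φ y| ≤ (K * dist x y) * |M| := by
        rw [abs_mul]; gcongr
      have e : a x * φ x - a y * φ y = a x * (φ x - φ y) + (a x - a y) * φ y := by ring
      rw [e]
      refine (abs_add_le _ _).trans ?_
      nlinarith
    · have e : a x * φ x - a y * φ y = a x * (φ x - φ y) := by rw [hφ0 y hy]; ring
      rw [e]
      have : 0 ≤ (K : ℝ) * |M| * dist x y := by positivity
      nlinarith
  refine ⟨⟨K * |M| + |A| * D, by positivity⟩, LipschitzWith.of_dist_le_mul fun x y => ?_⟩
  rw [Real.dist_eq]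
  change _ ≤ (K * |M| + |A| * D) * dist x y
  by_cases hx : x ∈ s
  · exact key x hx y
  · by_cases hy : y ∈ s
    · rw [abs_sub_comm, dist_comm]
      exact key y hy x
    · rw [hφ0 x hx, hφ0 y hy]
      simp only [mul_zero, sub_self, abs_zero]
      positivity

lemma inner_toLp {α : Type*} [MeasurableSpace α] {μ : Measure α} {f g : α → ℝ} (hf : MemLp f 2 μ)
    (hg : MemLp g 2 μ) : inner ℝ hf.toLp hg.toLp = ∫ x, f x * g x ∂μ := by
  rw [L2.inner_def]
  refine integral_congr_ae ?_
  filter_upwards [hf.coeFn_toLp, hg.coeFn_toLp] with x h1 h2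
  rw [h1, h2]
  simp [mul_comm]

variable {N m : ℕ} {Ω : Set (Eu N)}

lemma C01.eq_zero_of_notMem (u : C01 Ω) {x : Eu N} (hx : x ∉ Ω) : (u : Eu N → ℝ) x = 0 :=
  image_eq_zero_of_notMem_tsupport fun h => hx (u.2.2.2 h)

lemma C01.exists_lipschitzWith (u : C01 Ω) : ∃ C, LipschitzWith C (u : Eu N → ℝ) :=
  u.2.1.lipschitzWith_of_hasCompactSupport u.2.2.1 one_ne_zero

lemma C01.fderiv_apply (u : C01 Ω) (x w : Eu N) :
    fderiv ℝ (u : Eu N → ℝ) x w = ∑ i, w i * partialDeriv i u x := by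
  conv_lhs => rw [← (EuclideanSpace.basisFun (Fin N) ℝ).sum_repr w]
  simp [partialDeriv]

lemma C01.partialDeriv_eq_lineDeriv (u : C01 Ω) (i : Fin N) (x : Eu N) :
    partialDeriv i (u : Eu N → ℝ) x = lineDeriv ℝ (u : Eu N → ℝ) x (EuclideanSpace.single i 1) :=
  (((u.2.1.differentiable one_ne_zero) x).lineDeriv_eq_fderiv).symm

/-- `C_0^1(Ω)` is dense in `L²(Ω)`. -/
lemma denseRange_C01_toL2 (hΩ : IsOpen Ω) (hΩb : Bornology.IsBounded Ω) :
    DenseRange (C01.toL2 Ω) := by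
  have h : (LinearMap.range (C01.toL2 Ω))ᗮ = ⊥ := by
    rw [Submodule.eq_bot_iff]
    intro g hg
    have hg' : ∀ u : C01 Ω, ∫ x in Ω, (u : Eu N → ℝ) x * g x = 0 := by
      intro u
      have h1 := (Submodule.mem_orthogonal _ _).1 hg (C01.toL2 Ω u) ⟨u, rfl⟩
      have h2 := inner_toLp (C01.memLp u 2) (Lp.memLp g)
      rw [Lp.toLp_coeFn] at h2
      rw [← h2]
      exact h1
    have h0 : ∀ᵐ x ∂volume, x ∈ Ω → g x = 0 := by
      refine hΩ.ae_eq_zero_of_integral_contDiff_smul_eq_zero ?_ fun φ hφ hφc hφs => ?_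
      · have : IsFiniteMeasure (volume.restrict Ω) := ⟨by simpa using hΩb.measure_lt_top⟩
        have hgi : IntegrableOn g Ω := (Lp.memLp g).integrable one_le_two
        exact hgi.locallyIntegrableOn
      · have h3 := hg' ⟨φ, hφ.of_le (by exact_mod_cast le_top), hφc, hφs⟩
        refine Eq.trans (setIntegral_eq_integral_of_forall_compl_eq_zero fun x hx => ?_).symm h3
        rw [image_eq_zero_of_notMem_tsupport fun h => hx (hφs h), zero_smul]
    refine (Lp.eq_zero_iff_ae_eq_zero).2 ?_
    rw [EventuallyEq, ae_restrict_iff' hΩ.measurableSet]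
    exact h0
  have := (Submodule.dense_iff_topologicalClosure_eq_top).2
    ((Submodule.topologicalClosure_eq_top_iff).2 h)
  exact this

namespace XEllipticOperator

variable (L : XEllipticOperator N m)

lemma memLp_field (Ω : Set (Eu N)) (k : Fin m) (u : C01 Ω) :
    MemLp (fun x => fderiv ℝ (u : Eu N → ℝ) x (L.X k x)) 2 (volume.restrict Ω) := by
  have hc : Continuous fun x => fderiv ℝ (u : Eu N → ℝ) x (L.X k x) :=
    (u.2.1.continuous_fderiv one_ne_zero).clm_apply (L.locallyLipschitz_X k).continuous
  refine (hc.memLp_of_hasCompactSupport ?_).restrict Ω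
  refine (u.2.2.1.fderiv (𝕜 := ℝ)).mono fun x hx => ?_
  simp only [Function.mem_support] at hx ⊢
  intro h0
  simp [h0] at hx

/-- The derivative `u ↦ X_k u` along the vector field `X_k`, from `C_0^1(Ω)` to `L²(Ω)`. -/
def fieldDeriv (Ω : Set (Eu N)) (k : Fin m) : C01 Ω →ₗ[ℝ] L2 Ω where
  toFun u := (L.memLp_field Ω k u).toLp
  map_add' u v := by
    rw [← MemLp.toLp_add]
    refine MemLp.toLp_congr _ _ (Eventually.of_forall fun x => ?_)
    simp only [Pi.add_apply, C01.fderiv_apply, partialDeriv_add, mul_add, Finset.sum_add_distrib]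
  map_smul' c u := by
    rw [RingHom.id_apply, ← MemLp.toLp_const_smul]
    refine MemLp.toLp_congr _ _ (Eventually.of_forall fun x => ?_)
    simp only [Pi.smul_apply, C01.fderiv_apply, partialDeriv_smul, smul_eq_mul, Finset.mul_sum]
    exact Finset.sum_congr rfl fun i _ => by ring

lemma normH_sq_eq (u : C01 Ω) : L.normH Ω u ^ 2 = ∑ k, ‖L.fieldDeriv Ω k u‖ ^ 2 := by
  rw [normH, Real.sq_sqrt (Finset.sum_nonneg fun k _ => integral_nonneg fun x => sq_nonneg _)]
  refine Finset.sum_congr rfl fun k _ => ?_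
  rw [← real_inner_self_eq_norm_sq]
  refine Eq.trans ?_ (inner_toLp (L.memLp_field Ω k u) (L.memLp_field Ω k u)).symm
  simp only [sq]

lemma norm_ofC01_sq (u : C01 Ω) : ‖L.ofC01 Ω u‖ ^ 2 = L.form Ω u u := by
  rw [← L.inner_ofC01, real_inner_self_eq_norm_sq]

/-- A bound for the map `X_k` in terms of the norm of `H`. -/
lemma exists_norm_fieldDeriv_le (k : Fin m) :
    ∃ C, ∀ u : C01 Ω, ‖L.fieldDeriv Ω k u‖ ≤ C * ‖L.ofC01 Ω u‖ := by
  obtain ⟨D, hD, h⟩ := L.form_equiv_normH Ω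
  refine ⟨Real.sqrt D, fun u => ?_⟩
  have h1 := (h u).1
  rw [← L.norm_ofC01_sq, inv_mul_le_iff₀ hD, L.normH_sq_eq] at h1
  have h2 := Finset.single_le_sum (f := fun k => ‖L.fieldDeriv Ω k u‖ ^ 2)
    (fun k _ => sq_nonneg _) (Finset.mem_univ k)
  rw [← Real.sqrt_sq (norm_nonneg (L.ofC01 Ω u)), ← Real.sqrt_mul hD.le]
  exact Real.le_sqrt_of_sq_le (h2.trans h1)

/-- The extension of `X_k` to a bounded operator `H → L²(Ω)`. -/
def fieldDerivH (Ω : Set (Eu N)) (k : Fin m) : L.H Ω →L[ℝ] L2 Ω :=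
  LinearMap.extendOfNorm (L.fieldDeriv Ω k) (L.ofC01 Ω)

lemma fieldDerivH_ofC01 (k : Fin m) (u : C01 Ω) :
    L.fieldDerivH Ω k (L.ofC01 Ω u) = L.fieldDeriv Ω k u :=
  LinearMap.extendOfNorm_eq (L.denseRange_ofC01 Ω) (L.exists_norm_fieldDeriv_le k) u

lemma exists_norm_sq_le_fieldDerivH :
    ∃ C, ∀ x : L.H Ω, ‖x‖ ^ 2 ≤ C * ∑ k, ‖L.fieldDerivH Ω k x‖ ^ 2 := by
  obtain ⟨D, hD, h⟩ := L.form_equiv_normH Ω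
  refine ⟨D, fun x => ?_⟩
  refine (L.denseRange_ofC01 Ω).induction_on (p := fun x : L.H Ω =>
    ‖x‖ ^ 2 ≤ D * ∑ k, ‖L.fieldDerivH Ω k x‖ ^ 2) x ?_ fun u => ?_
  · exact isClosed_le (by fun_prop) (by fun_prop)
  · simp only [fieldDerivH_ofC01, ← normH_sq_eq, norm_ofC01_sq]
    exact (h u).2

/-- The formal adjoint of `X_k` applied to a test function `φ` is a bounded function, because
`X_k` is locally Lipschitz; so the distributional derivative `X_k u` depends on `u ∈ L²` only. -/
lemma exists_inner_fieldDeriv_eq (hΩb : Bornology.IsBounded Ω) (k : Fin m) (φ : C01 Ω) :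
    ∃ h : L2 Ω, ∀ u : C01 Ω,
      inner ℝ (L.fieldDeriv Ω k u) (C01.toL2 Ω φ) = inner ℝ (C01.toL2 Ω u) h := by
  let g : Fin N → Eu N → ℝ := fun i x => L.X k x i * (φ : Eu N → ℝ) x
  have hgL : ∀ i, ∃ C, LipschitzWith C (g i) := by
    intro i
    have hs : IsCompact (tsupport (φ : Eu N → ℝ)) := φ.2.2.1
    obtain ⟨K, hK⟩ := LocallyLipschitzOn.exists_lipschitzOnWith_of_compact hs
      ((L.locallyLipschitz_X k).locallyLipschitzOn (s := tsupport (φ : Eu N → ℝ)))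
    have hK' : LipschitzOnWith (1 * K) (fun x => L.X k x i) (tsupport (φ : Eu N → ℝ)) := by
      have h1 : LipschitzWith 1 fun w : Eu N => w i := LipschitzWith.of_dist_le_mul fun x y => by
        simpa [dist_eq_norm] using PiLp.norm_apply_le (x - y) i
      exact h1.comp_lipschitzOnWith hK
    obtain ⟨A, hA⟩ := hs.exists_bound_of_continuousOn hK'.continuousOn
    obtain ⟨D, hD⟩ := C01.exists_lipschitzWith φ
    obtain ⟨M, hM⟩ := φ.2.2.1.exists_bound_of_continuous φ.2.1.continuous
    exact exists_lipschitzWith_mul hK' hA hD hM fun x hx => image_eq_zero_of_notMem_tsupport hx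
  choose C hC using hgL
  have hgc : ∀ i, HasCompactSupport (g i) := fun i => φ.2.2.1.mul_left
  let e : Fin N → Eu N := fun i => EuclideanSpace.single i 1
  let d : Fin N → Eu N → ℝ := fun i x => lineDeriv ℝ (g i) x (-e i)
  have : IsFiniteMeasure (volume.restrict Ω) := ⟨by simpa using hΩb.measure_lt_top⟩
  have hd : ∀ i, MemLp (d i) 2 (volume.restrict Ω) := by
    intro i
    refine MemLp.of_bound (measurable_lineDeriv (hC i).continuous).aestronglyMeasurable
      (C i * ‖-e i‖) (Eventually.of_forall fun x => ?_)
    exact norm_lineDeriv_le_of_lipschitz ℝ (hC i)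
  have hd' : MemLp (fun x => ∑ i, d i x) 2 (volume.restrict Ω) :=
    memLp_finsetSum _ fun i _ => hd i
  refine ⟨hd'.toLp, fun u => ?_⟩
  obtain ⟨D, hD⟩ := C01.exists_lipschitzWith u
  have hLip : ∀ i, ∫ x, partialDeriv i (u : Eu N → ℝ) x * g i x = ∫ x, d i x * (u : Eu N → ℝ) x := by
    intro i
    simp only [C01.partialDeriv_eq_lineDeriv]
    exact LipschitzWith.integral_lineDeriv_mul_eq hD (hC i) (hgc i) _
  have hi1 : ∀ i, Integrable (fun x => partialDeriv i (u : Eu N → ℝ) x * g i x) := fun i =>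
    ((C01.continuous_partialDeriv u i).mul (hC i).continuous).integrable_of_hasCompactSupport
      ((hgc i).mul_left)
  have hi2 : ∀ i, Integrable (fun x => d i x * (u : Eu N → ℝ) x) (volume.restrict Ω) := fun i =>
    (hd i).integrable_mul (C01.memLp u 2)
  have hset : ∀ (F : Eu N → ℝ), ∫ x in Ω, F x * (u : Eu N → ℝ) x = ∫ x, F x * (u : Eu N → ℝ) x :=
    fun F => setIntegral_eq_integral_of_forall_compl_eq_zero fun x hx => by
      rw [C01.eq_zero_of_notMem u hx, mul_zero]
  calc inner ℝ (L.fieldDeriv Ω k u) (C01.toL2 Ω φ)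
      = ∫ x in Ω, fderiv ℝ (u : Eu N → ℝ) x (L.X k x) * (φ : Eu N → ℝ) x :=
        inner_toLp (L.memLp_field Ω k u) (C01.memLp φ 2)
    _ = ∫ x, fderiv ℝ (u : Eu N → ℝ) x (L.X k x) * (φ : Eu N → ℝ) x :=
        setIntegral_eq_integral_of_forall_compl_eq_zero fun x hx => by
          rw [C01.eq_zero_of_notMem φ hx, mul_zero]
    _ = ∫ x, ∑ i, partialDeriv i (u : Eu N → ℝ) x * g i x := by
        congr 1
        ext x
        rw [C01.fderiv_apply, Finset.sum_mul]
        exact Finset.sum_congr rfl fun i _ => by simp only [g]; ring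
    _ = ∑ i, ∫ x in Ω, d i x * (u : Eu N → ℝ) x := by
        rw [integral_finsetSum _ fun i _ => hi1 i]
        exact Finset.sum_congr rfl fun i _ => by rw [hLip, hset]
    _ = ∫ x in Ω, (u : Eu N → ℝ) x * ∑ i, d i x := by
        rw [← integral_finsetSum _ fun i _ => hi2 i]
        simp only [Finset.mul_sum, mul_comm]
    _ = inner ℝ (C01.toL2 Ω u) hd'.toLp := (inner_toLp (C01.memLp u 2) hd').symm

variable {Q : ℝ}

/-- The form is closable: the embedding `H → L²(Ω)` is injective. -/
lemma toL2_injective (hΩ : IsOpen Ω) (hΩb : Bornology.IsBounded Ω) (hQ : 2 < Q)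
    (hemb : L.SobolevEmbedding Ω Q) {x : L.H Ω} (hx : L.toL2 Ω x = 0) : x = 0 := by
  have h0 : ∀ k, L.fieldDerivH Ω k x = 0 := by
    intro k
    -- `⟨X_k y, φ⟩ = ⟨y, X_k^* φ⟩` extends by density from `C_0^1(Ω)` to `y ∈ H`
    refine (denseRange_C01_toL2 hΩ hΩb).eq_zero_of_inner_left (𝕜 := ℝ) fun φ => ?_
    obtain ⟨h, hh⟩ := L.exists_inner_fieldDeriv_eq hΩb k φ
    have key : ∀ y : L.H Ω,
        inner ℝ (L.fieldDerivH Ω k y) (C01.toL2 Ω φ) = inner ℝ (L.toL2 Ω y) h := by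
      intro y
      refine (L.denseRange_ofC01 Ω).induction_on (p := fun y : L.H Ω =>
        inner ℝ (L.fieldDerivH Ω k y) (C01.toL2 Ω φ) = inner ℝ (L.toL2 Ω y) h) y ?_ fun u => ?_
      · exact isClosed_eq (by fun_prop) (by fun_prop)
      · rw [fieldDerivH_ofC01, L.toL2_ofC01 Ω hQ hemb, hh]
    rw [key, hx, inner_zero_left]
  obtain ⟨C, hC⟩ := L.exists_norm_sq_le_fieldDerivH (Ω := Ω)
  have := hC x
  simp only [h0, norm_zero] at this
  have h1 : ‖x‖ ^ 2 ≤ 0 := by simpa using this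
  exact norm_eq_zero.1 (pow_eq_zero_iff two_ne_zero |>.1 (le_antisymm h1 (sq_nonneg _)))

lemma denseRange_toL2 (hΩ : IsOpen Ω) (hΩb : Bornology.IsBounded Ω) (hQ : 2 < Q)
    (hemb : L.SobolevEmbedding Ω Q) : DenseRange (L.toL2 Ω) :=
  (denseRange_C01_toL2 hΩ hΩb).mono (by
    rintro _ ⟨u, rfl⟩
    exact ⟨L.ofC01 Ω u, L.toL2_ofC01 Ω hQ hemb u⟩)

end XEllipticOperator

end Embedding

/-! ### The superposition operator -/

section Nemytskii

/-- Continuity of a nonlinearity satisfying the growth condition. -/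
lemma continuous_of_growth {f : ℝ → ℝ} {c γ : ℝ} (hγ : 0 < γ)
    (hf : ∀ x y : ℝ, |f x - f y| ≤ c * |x - y| * (1 + |x| ^ γ + |y| ^ γ)) : Continuous f := by
  rw [continuous_iff_continuousAt]
  intro y
  have hc : Continuous fun x : ℝ => c * |x - y| * (1 + |x| ^ γ + |y| ^ γ) :=
    (continuous_const.mul (continuous_id.sub continuous_const).abs).mul
      ((continuous_const.add (continuous_abs.rpow_const fun _ => Or.inr hγ.le)).add
        continuous_const)
  rw [ContinuousAt, tendsto_iff_norm_sub_tendsto_zero]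
  refine squeeze_zero (fun _ => norm_nonneg _) (fun x => hf x y) ?_
  simpa using hc.tendsto y

/-- Hölder's inequality with exponents `2(γ+1)` and `2(γ+1)/γ` bounds the increment of a
superposition operator of growth `γ + 1` in `L²`. -/
lemma eLpNorm_comp_sub_comp_le {α : Type*} [MeasurableSpace α] {μ : Measure α} {f : ℝ → ℝ}
    {c γ : ℝ} (hc : 0 ≤ c) (hγ : 0 < γ)
    (hf : ∀ x y : ℝ, |f x - f y| ≤ c * |x - y| * (1 + |x| ^ γ + |y| ^ γ)) {u v : α → ℝ}
    (hu : AEStronglyMeasurable u μ) (hv : AEStronglyMeasurable v μ) :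
    eLpNorm (fun x => f (u x) - f (v x)) 2 μ ≤ ENNReal.ofReal c *
      (eLpNorm (fun x => u x - v x) (ENNReal.ofReal (2 * (γ + 1))) μ *
      (eLpNorm (fun _ => (1 : ℝ)) (ENNReal.ofReal (2 * (γ + 1) / γ)) μ +
        eLpNorm u (ENNReal.ofReal (2 * (γ + 1))) μ ^ γ +
        eLpNorm v (ENNReal.ofReal (2 * (γ + 1))) μ ^ γ)) := by
  set r := 2 * (γ + 1) with hr
  have hr0 : 0 < r := by positivity
  have hp1 : 1 ≤ ENNReal.ofReal (r / γ) := by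
    rw [← ENNReal.ofReal_one]
    refine ENNReal.ofReal_le_ofReal ?_
    rw [le_div_iff₀ hγ]
    linarith
  have hpow : ∀ w : α → ℝ, eLpNorm (fun x => |w x| ^ γ) (ENNReal.ofReal (r / γ)) μ
      = eLpNorm w (ENNReal.ofReal r) μ ^ γ := by
    intro w
    have := eLpNorm_norm_rpow (p := ENNReal.ofReal (r / γ)) (μ := μ) w hγ
    rw [← ENNReal.ofReal_mul (by positivity), div_mul_cancel₀ _ hγ.ne'] at this
    exact this
  have hmpow : ∀ w : α → ℝ, AEStronglyMeasurable w μ →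
      AEStronglyMeasurable (fun x => |w x| ^ γ) μ := fun w hw =>
    (continuous_abs.rpow_const fun _ => Or.inr hγ.le).comp_aestronglyMeasurable hw
  have htri : ENNReal.HolderTriple (ENNReal.ofReal r) (ENNReal.ofReal (r / γ)) 2 := by
    constructor
    have e2 : (2 : ℝ≥0∞) = ENNReal.ofReal 2 := by simp
    rw [e2, ← ENNReal.ofReal_inv_of_pos hr0, ← ENNReal.ofReal_inv_of_pos (by positivity),
      ← ENNReal.ofReal_inv_of_pos two_pos, ← ENNReal.ofReal_add (by positivity) (by positivity)]
    congr 1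
    -- `1/r + γ/r = 1/2` for `r = 2(γ + 1)`
    rw [hr]
    field_simp
    ring
  have hm1 : AEStronglyMeasurable (fun _ : α => (1 : ℝ)) μ := aestronglyMeasurable_const
  have hg : AEStronglyMeasurable (fun x => 1 + |u x| ^ γ + |v x| ^ γ) μ :=
    (hm1.add (hmpow u hu)).add (hmpow v hv)
  have hH := eLpNorm_smul_le_mul_eLpNorm (p := ENNReal.ofReal r) (q := ENNReal.ofReal (r / γ))
    (r := 2) hg (hu.sub hv)
  have hmono : eLpNorm (fun x => f (u x) - f (v x)) 2 μ ≤
      eLpNorm (c • ((u - v) • fun x => 1 + |u x| ^ γ + |v x| ^ γ)) 2 μ := by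
    refine eLpNorm_mono fun x => ?_
    have h0 : 0 ≤ 1 + |u x| ^ γ + |v x| ^ γ := by positivity
    simp only [Pi.smul_apply, Pi.mul_apply, Pi.sub_apply, smul_eq_mul, Real.norm_eq_abs,
      abs_mul, abs_of_nonneg hc, abs_of_nonneg h0]
    exact (hf (u x) (v x)).trans (le_of_eq (mul_assoc _ _ _))
  refine hmono.trans ?_
  rw [eLpNorm_const_smul, Real.enorm_eq_ofReal hc]
  refine mul_le_mul_right (hH.trans (mul_le_mul_right ?_ _)) _
  refine (eLpNorm_add_le (hm1.add (hmpow u hu)) (hmpow v hv) hp1).trans ?_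
  rw [hpow v]
  refine add_le_add_left ((eLpNorm_add_le hm1 (hmpow u hu) hp1).trans ?_) _
  rw [hpow u]

variable {N m : ℕ} {Ω : Set (Eu N)} (L : XEllipticOperator N m) {Q : ℝ}

namespace XEllipticOperator

/-- The Sobolev inequality extends from `C_0^1(Ω)` to `H`, by Fatou's lemma. -/
lemma exists_eLpNorm_toL2_le (hQ : 2 < Q) (hemb : L.SobolevEmbedding Ω Q) {r : ℝ} (hr1 : 1 ≤ r)
    (hr : r ≤ 2 * Q / (Q - 2)) : ∃ C : ℝ, 0 ≤ C ∧ ∀ u : L.H Ω,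
      eLpNorm (L.toL2 Ω u) (ENNReal.ofReal r) (volume.restrict Ω) ≤ ENNReal.ofReal (C * ‖u‖) := by
  obtain ⟨C, hC⟩ := hemb.1 r hr1 hr
  obtain ⟨D, hD, h⟩ := L.form_equiv_normH Ω
  have hC01 : ∀ u : C01 Ω, eLpNorm (L.toL2 Ω (L.ofC01 Ω u)) (ENNReal.ofReal r)
      (volume.restrict Ω) ≤ ENNReal.ofReal (|C| * Real.sqrt D * ‖L.ofC01 Ω u‖) := by
    intro u
    have e : L.toL2 Ω (L.ofC01 Ω u) =ᵐ[volume.restrict Ω] (u : Eu N → ℝ) := by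
      rw [L.toL2_ofC01 Ω hQ hemb]
      exact (C01.memLp u 2).coeFn_toLp
    rw [eLpNorm_congr_ae e]
    refine (hC u).trans (ENNReal.ofReal_le_ofReal ?_)
    have h1 := (h u).1
    rw [← L.norm_ofC01_sq, inv_mul_le_iff₀ hD] at h1
    have h2 : L.normH Ω u ≤ Real.sqrt D * ‖L.ofC01 Ω u‖ := by
      rw [← Real.sqrt_sq (norm_nonneg (L.ofC01 Ω u)), ← Real.sqrt_mul hD.le]
      exact Real.le_sqrt_of_sq_le h1
    have h3 : 0 ≤ L.normH Ω u := Real.sqrt_nonneg _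
    rw [mul_assoc]
    exact mul_le_mul (le_abs_self C) h2 h3 (abs_nonneg C)
  refine ⟨|C| * Real.sqrt D, by positivity, fun u => ?_⟩
  obtain ⟨w, hw, hwu⟩ := mem_closure_iff_seq_limit.1 (L.denseRange_ofC01 Ω u)
  choose v hv using hw
  have hconv : Tendsto (fun n => L.toL2 Ω (w n)) atTop (𝓝 (L.toL2 Ω u)) :=
    ((L.toL2 Ω).continuous.tendsto u).comp hwu
  obtain ⟨k, hk, hae⟩ := (tendstoInMeasure_of_tendsto_Lp hconv).exists_seq_tendsto_ae
  refine (Lp.eLpNorm_lim_le_liminf_eLpNorm (f := fun n => L.toL2 Ω (w (k n)))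
    (fun n => Lp.aestronglyMeasurable _) _ hae).trans ?_
  have hlim : Tendsto (fun n => ENNReal.ofReal (|C| * Real.sqrt D * ‖w (k n)‖)) atTop
      (𝓝 (ENNReal.ofReal (|C| * Real.sqrt D * ‖u‖))) :=
    (ENNReal.continuous_ofReal.tendsto _).comp
      ((hwu.comp hk.tendsto_atTop).norm.const_mul (|C| * Real.sqrt D))
  rw [← hlim.liminf_eq]
  refine liminf_le_liminf (Eventually.of_forall fun n => ?_)
  rw [← hv (k n)]
  exact hC01 _

variable {f : ℝ → ℝ} {c γ : ℝ}

/-- The superposition operator is Lipschitz from bounded sets of `H` to `L²(Ω)`. -/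
lemma exists_eLpNorm_comp_toL2_le (hΩb : Bornology.IsBounded Ω) (hQ : 2 < Q)
    (hemb : L.SobolevEmbedding Ω Q) (hc : 0 ≤ c) (hγ : 0 < γ)
    (hγQ : γ ≤ (2 * Q / (Q - 2) - 2) / 2)
    (hf : ∀ x y : ℝ, |f x - f y| ≤ c * |x - y| * (1 + |x| ^ γ + |y| ^ γ)) (R : ℝ) :
    ∃ K : ℝ≥0, ∀ u v : L.H Ω, ‖u‖ ≤ R → ‖v‖ ≤ R →
      eLpNorm (fun x => f (L.toL2 Ω u x) - f (L.toL2 Ω v x)) 2 (volume.restrict Ω)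
        ≤ ENNReal.ofReal (K * ‖u - v‖) := by
  have : IsFiniteMeasure (volume.restrict Ω) := ⟨by simpa using hΩb.measure_lt_top⟩
  obtain ⟨C, hC0, hC⟩ := L.exists_eLpNorm_toL2_le hQ hemb (r := 2 * (γ + 1)) (by linarith)
    (by linarith)
  set B : ℝ≥0∞ := eLpNorm (fun _ => (1 : ℝ)) (ENNReal.ofReal (2 * (γ + 1) / γ)) (volume.restrict Ω)
    + ENNReal.ofReal (C * R) ^ γ + ENNReal.ofReal (C * R) ^ γ with hB
  have hBt : B ≠ ⊤ := by
    have h1 := (memLp_const (1 : ℝ) (μ := volume.restrict Ω)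
      (p := ENNReal.ofReal (2 * (γ + 1) / γ))).eLpNorm_ne_top
    have h2 : ENNReal.ofReal (C * R) ^ γ ≠ ⊤ := ENNReal.rpow_ne_top_of_nonneg hγ.le ENNReal.ofReal_ne_top
    exact ENNReal.add_ne_top.2 ⟨ENNReal.add_ne_top.2 ⟨h1, h2⟩, h2⟩
  refine ⟨Real.toNNReal (c * C * B.toReal), fun u v hu hv => ?_⟩
  refine (eLpNorm_comp_sub_comp_le hc hγ hf (Lp.aestronglyMeasurable _)
    (Lp.aestronglyMeasurable _)).trans ?_
  have hsub : eLpNorm (fun x => L.toL2 Ω u x - L.toL2 Ω v x) (ENNReal.ofReal (2 * (γ + 1)))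
      (volume.restrict Ω) ≤ ENNReal.ofReal (C * ‖u - v‖) := by
    refine le_trans (le_of_eq ?_) (hC (u - v))
    refine eLpNorm_congr_ae ?_
    rw [map_sub]
    exact (Lp.coeFn_sub _ _).symm
  have hle : ∀ w : L.H Ω, ‖w‖ ≤ R → eLpNorm (L.toL2 Ω w) (ENNReal.ofReal (2 * (γ + 1)))
      (volume.restrict Ω) ≤ ENNReal.ofReal (C * R) := fun w hw =>
    (hC w).trans (ENNReal.ofReal_le_ofReal (by gcongr))
  calc _ ≤ ENNReal.ofReal c * (ENNReal.ofReal (C * ‖u - v‖) * B) := by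
        rw [hB]
        gcongr
        · exact hle u hu
        · exact hle v hv
    _ = ENNReal.ofReal (c * C * B.toReal * ‖u - v‖) := by
        rw [← ENNReal.ofReal_toReal hBt, ENNReal.toReal_ofReal ENNReal.toReal_nonneg,
          ← ENNReal.ofReal_mul (by positivity), ← ENNReal.ofReal_mul hc]
        congr 1
        ring
    _ = _ := by
        rw [Real.coe_toNNReal _ (by positivity)]

lemma memLp_comp_toL2 (hΩb : Bornology.IsBounded Ω) (hQ : 2 < Q)
    (hemb : L.SobolevEmbedding Ω Q) (hc : 0 ≤ c) (hγ : 0 < γ)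
    (hγQ : γ ≤ (2 * Q / (Q - 2) - 2) / 2)
    (hf : ∀ x y : ℝ, |f x - f y| ≤ c * |x - y| * (1 + |x| ^ γ + |y| ^ γ)) (u : L.H Ω) :
    MemLp (fun x => f (L.toL2 Ω u x)) 2 (volume.restrict Ω) := by
  have : IsFiniteMeasure (volume.restrict Ω) := ⟨by simpa using hΩb.measure_lt_top⟩
  have hm : ∀ w : L.H Ω, AEStronglyMeasurable (fun x => f (L.toL2 Ω w x)) (volume.restrict Ω) :=
    fun w => (continuous_of_growth hγ hf).comp_aestronglyMeasurable (Lp.aestronglyMeasurable _)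
  obtain ⟨K, hK⟩ := L.exists_eLpNorm_comp_toL2_le hΩb hQ hemb hc hγ hγQ hf ‖u‖
  have h1 : MemLp (fun x => f (L.toL2 Ω u x) - f (L.toL2 Ω 0 x)) 2 (volume.restrict Ω) :=
    ⟨(hm u).sub (hm 0), (hK u 0 le_rfl (by simp)).trans_lt ENNReal.ofReal_lt_top⟩
  have h2 : MemLp (fun x => f (L.toL2 Ω 0 x)) 2 (volume.restrict Ω) := by
    refine (memLp_congr_ae ?_).2 (memLp_const (f 0))
    rw [map_zero]
    filter_upwards [Lp.coeFn_zero ℝ 2 (volume.restrict Ω)] with x hx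
    rw [hx, Pi.zero_apply]
  refine (h1.add h2).ae_eq (Eventually.of_forall fun x => ?_)
  simp

lemma exists_lipschitzOnWith_nemytskii (hΩb : Bornology.IsBounded Ω) (hQ : 2 < Q)
    (hemb : L.SobolevEmbedding Ω Q) (hc : 0 ≤ c) (hγ : 0 < γ)
    (hγQ : γ ≤ (2 * Q / (Q - 2) - 2) / 2)
    (hf : ∀ x y : ℝ, |f x - f y| ≤ c * |x - y| * (1 + |x| ^ γ + |y| ^ γ)) (R : ℝ) :
    ∃ K : ℝ≥0, LipschitzOnWith K (fun u : L.H Ω => nemytskii Ω f (L.toL2 Ω u))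
      (Metric.closedBall 0 R) := by
  obtain ⟨K, hK⟩ := L.exists_eLpNorm_comp_toL2_le hΩb hQ hemb hc hγ hγQ hf R
  refine ⟨K, LipschitzOnWith.of_dist_le_mul fun u hu v hv => ?_⟩
  rw [mem_closedBall_zero_iff] at hu hv
  have hmem := L.memLp_comp_toL2 hΩb hQ hemb hc hγ hγQ hf
  simp only [nemytskii]
  rw [dif_pos (hmem u), dif_pos (hmem v), dist_eq_norm, dist_eq_norm, ← MemLp.toLp_sub,
    Lp.norm_toLp]
  exact ENNReal.toReal_le_of_le_ofReal (by positivity) (hK u v hu hv)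

end XEllipticOperator

end Nemytskii

/-! ### The inverse wave operator and mild solutions -/

section Calculus

lemma contDiffOn_one_of_hasDerivAt {F : Type*} [NormedAddCommGroup F] [NormedSpace ℝ F]
    {x g : ℝ → F} {U : Set ℝ} (hU : IsOpen U) (hx : ∀ t ∈ U, HasDerivAt x (g t) t)
    (hg : ContinuousOn g U) : ContDiffOn ℝ 1 x U := by
  rw [show (1 : WithTop ℕ∞) = 0 + 1 by simp, contDiffOn_succ_iff_deriv_of_isOpen hU]
  refine ⟨fun t ht => (hx t ht).differentiableAt.differentiableWithinAt, by simp, ?_⟩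
  rw [contDiffOn_zero]
  exact hg.congr fun t ht => (hx t ht).deriv

lemma hasDerivAt_of_fst_of_snd {F G : Type*} [NormedAddCommGroup F] [NormedSpace ℝ F]
    [NormedAddCommGroup G] [NormedSpace ℝ G] {x : ℝ → WithLp 2 (F × G)} {y : WithLp 2 (F × G)}
    {t : ℝ} (h1 : HasDerivAt (fun τ => (x τ).fst) y.fst t)
    (h2 : HasDerivAt (fun τ => (x τ).snd) y.snd t) : HasDerivAt x y t :=
  (WithLp.prodContinuousLinearEquiv 2 ℝ F G).symm.toContinuousLinearMap.hasFDerivAt.comp_hasDerivAt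
    t (h1.prodMk h2)

variable {E : Type*} [NormedAddCommGroup E] [InnerProductSpace ℝ E]

namespace IsUnitaryGroup

variable {S : ℝ → E →L[ℝ] E} {K : E →L[ℝ] E}

/-- The group run backwards. -/
lemma reverse (h : IsUnitaryGroup S K) : IsUnitaryGroup (fun t => S (-t)) (-K) where
  zero := by simpa using h.zero
  add t r := by rw [neg_add, h.add]
  norm_map t x := h.norm_map _ x
  continuous x := (h.continuous x).comp continuous_neg
  comm t x := by simp [h.comm]
  hasDerivAt y t := by
    have := ((h.hasDerivAt y (-t)).scomp t (hasDerivAt_neg t)).neg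
    simpa [Function.comp_def, Pi.neg_def] using this

/-- The product rule for `t ↦ S t (y t)` at a time where `y t` lies in the range of `K`, the
domain of the generator. -/
lemma hasDerivWithinAt_apply (h : IsUnitaryGroup S K) {y : ℝ → E} {y' x : E} {D : Set ℝ} {t : ℝ}
    (hy : HasDerivWithinAt y y' D t) (hyx : y t = K x) :
    HasDerivWithinAt (fun τ => S τ (y τ)) (S t x + S t y') D t := by
  have h1 : HasDerivWithinAt (fun τ => S τ (y τ - y t)) (S t y') D t := by
    rw [hasDerivWithinAt_iff_tendsto_slope] at hy ⊢
    have hτ : Tendsto (fun τ : ℝ => τ) (𝓝[D \ {t}] t) (𝓝 t) := nhdsWithin_le_nhds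
    have h2 := (h.continuous_uncurry.tendsto (t, y')).comp (hτ.prodMk_nhds hy)
    refine h2.congr fun τ => ?_
    simp [slope_def_module]
  have h3 : HasDerivWithinAt (fun τ => S τ (K x)) (S t x) D t := (h.hasDerivAt x t).hasDerivWithinAt
  refine (h3.add h1).congr (fun τ _ => ?_) ?_
  all_goals simp [← hyx]

end IsUnitaryGroup

variable [CompleteSpace E]

/-- A weakly differentiable curve whose weak derivative is continuous is differentiable. It is
enough to test with a dense set of vectors. -/
lemma hasDerivAt_of_inner {X : Type*} {e : X → E} (he : DenseRange e) {x g : ℝ → E} {U : Set ℝ}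
    (hU : IsOpen U) (hg : ContinuousOn g U)
    (h : ∀ a, ∀ t ∈ U, HasDerivAt (fun τ => inner ℝ (x τ) (e a)) (inner ℝ (g t) (e a)) t) :
    ∀ t ∈ U, HasDerivAt x (g t) t := by
  intro t ht
  obtain ⟨ε, hε, hεU⟩ := Metric.isOpen_iff.1 hU t ht
  have hsub : ∀ r ∈ Metric.ball t ε, uIcc t r ⊆ U := fun r hr =>
    ((convex_ball t ε).ordConnected.uIcc_subset (Metric.mem_ball_self hε) hr).trans hεU
  have hint : ∀ r ∈ Metric.ball t ε, IntervalIntegrable g volume t r := fun r hr =>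
    (hg.mono (hsub r hr)).intervalIntegrable
  have key : ∀ r ∈ Metric.ball t ε, x r = x t + ∫ τ in t..r, g τ := by
    intro r hr
    refine he.eq_of_inner_left (𝕜 := ℝ) fun a => ?_
    have h1 := intervalIntegral.integral_eq_sub_of_hasDerivAt (fun τ hτ => h a τ (hsub r hr hτ))
      ((((hg.mono (hsub r hr)).inner continuousOn_const)).intervalIntegrable)
    have h2 : inner ℝ (∫ τ in t..r, g τ) (e a) = ∫ τ in t..r, inner ℝ (g τ) (e a) := by
      have := (innerSL ℝ (e a)).intervalIntegral_comp_comm (hint r hr)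
      simp only [innerSL_apply_apply] at this
      rw [real_inner_comm, ← this]
      simp only [real_inner_comm]
    rw [inner_add_left, h2, h1]
    ring
  have hFTC := intervalIntegral.integral_hasDerivAt_right (a := t) (b := t) (f := g) (by simp)
    (hg.stronglyMeasurableAtFilter hU t ht) (hg.continuousAt (hU.mem_nhds ht))
  refine (hFTC.const_add (x t)).congr_of_eventuallyEq ?_
  filter_upwards [Metric.ball_mem_nhds t hε] with r hr using key r hr

end Calculus

namespace XEllipticOperator

variable {N m : ℕ} (L : XEllipticOperator N m) (Ω : Set (Eu N))

/-- The bounded inverse `(g, h) ↦ (-ι* h, ι g)` of the wave operator `Â (u, v) = (v, -A u)`, where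
`ι : H → L²(Ω)` is the embedding and `ι* = A⁻¹` its adjoint. -/
def waveInv : L.V Ω →L[ℝ] L.V Ω :=
  ((WithLp.prodContinuousLinearEquiv 2 ℝ (L.H Ω) (L2 Ω)).symm : L.H Ω × L2 Ω →L[ℝ] L.V Ω).comp
    (((-(L.toL2 Ω).adjoint.comp (WithLp.sndL 2 ℝ (L.H Ω) (L2 Ω)))).prod
      ((L.toL2 Ω).comp (WithLp.fstL 2 ℝ (L.H Ω) (L2 Ω))))

@[simp] lemma waveInv_fst (w : L.V Ω) :
    (L.waveInv Ω w).fst = -(L.toL2 Ω).adjoint w.snd := rfl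

@[simp] lemma waveInv_snd (w : L.V Ω) : (L.waveInv Ω w).snd = L.toL2 Ω w.fst := rfl

lemma inner_waveInv (x y : L.V Ω) :
    inner ℝ (L.waveInv Ω x) y = -inner ℝ x (L.waveInv Ω y) := by
  simp only [WithLp.prod_inner_apply, WithLp.ofLp_fst, WithLp.ofLp_snd, waveInv_fst, waveInv_snd,
    inner_neg_left, inner_neg_right, ContinuousLinearMap.adjoint_inner_left,
    ContinuousLinearMap.adjoint_inner_right]
  ring

lemma graphAhat_eq : L.graphAhat Ω = {p | p.1 = L.waveInv Ω p.2} := by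
  ext ⟨x, y⟩
  simp only [graphAhat, graphA, mem_ofPred_eq]
  constructor
  · rintro ⟨h1, h2⟩
    refine WithLp.ofLp_injective 2 (Prod.ext ?_ h1.symm)
    refine ext_inner_right ℝ fun φ => ?_
    rw [WithLp.ofLp_fst, h2 φ, WithLp.ofLp_fst, waveInv_fst, inner_neg_left, inner_neg_left,
      ContinuousLinearMap.adjoint_inner_left]
  · rintro rfl
    refine ⟨rfl, fun φ => ?_⟩
    rw [waveInv_fst, inner_neg_left, inner_neg_left, ContinuousLinearMap.adjoint_inner_left]

variable {Ω}

lemma waveInv_injective (hinj : ∀ x, L.toL2 Ω x = 0 → x = 0) (hdense : DenseRange (L.toL2 Ω))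
    (x : L.V Ω) (hx : L.waveInv Ω x = 0) : x = 0 := by
  have h1 : (L.toL2 Ω).adjoint x.snd = 0 := by
    have : (L.waveInv Ω x).fst = 0 := by rw [hx]; rfl
    simpa using this
  have h2 : L.toL2 Ω x.fst = 0 := by
    have : (L.waveInv Ω x).snd = 0 := by rw [hx]; rfl
    simpa using this
  refine WithLp.ofLp_injective 2 (Prod.ext (hinj _ h2) ?_)
  refine hdense.eq_zero_of_inner_left (𝕜 := ℝ) fun φ => ?_
  rw [WithLp.ofLp_snd, ← ContinuousLinearMap.adjoint_inner_left, h1, inner_zero_left]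

lemma toDual_eq (g : L2 Ω) : L.toDual Ω g = innerSL ℝ ((L.toL2 Ω).adjoint g) := by
  ext φ
  simp [toDual, ContinuousLinearMap.adjoint_inner_left]

/-- The vector field `G(t, z) = S(-t) f̂(t, S(t) z)` of the equation `z' = G(t, z)` solved by
`z(t) = S(-t) w(t)`. -/
def pulledField (S : ℝ → L.V Ω →L[ℝ] L.V Ω) (f β : ℝ → ℝ) (t : ℝ) (z : L.V Ω) : L.V Ω :=
  S (-t) (L.fhat Ω f β t (S t z))

lemma norm_toLp_inr (b : L2 Ω) : ‖(WithLp.toLp 2 (0, b) : L.V Ω)‖ = ‖b‖ := by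
  rw [WithLp.prod_norm_eq_of_L2]
  simp

lemma norm_snd_le (w : L.V Ω) : ‖w.snd‖ ≤ ‖w‖ := by
  rw [WithLp.prod_norm_eq_of_L2]
  exact Real.le_sqrt_of_sq_le (by nlinarith [sq_nonneg ‖w.fst‖])

lemma norm_fst_le (w : L.V Ω) : ‖w.fst‖ ≤ ‖w‖ := by
  rw [WithLp.prod_norm_eq_of_L2]
  exact Real.le_sqrt_of_sq_le (by nlinarith [sq_nonneg ‖w.snd‖])

variable {f β : ℝ → ℝ} {S : ℝ → L.V Ω →L[ℝ] L.V Ω}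

@[simp] lemma fhat_fst (t : ℝ) (w : L.V Ω) : (L.fhat Ω f β t w).fst = 0 := rfl

@[simp] lemma fhat_snd (t : ℝ) (w : L.V Ω) :
    (L.fhat Ω f β t w).snd = -(β t • w.snd) + nemytskii Ω f (L.toL2 Ω w.fst) := rfl

lemma norm_fhat_le (t : ℝ) (w : L.V Ω) :
    ‖L.fhat Ω f β t w‖ ≤ |β t| * ‖w‖ + ‖nemytskii Ω f (L.toL2 Ω w.fst)‖ := by
  rw [fhat, norm_toLp_inr]
  refine (norm_add_le _ _).trans ?_
  rw [norm_neg, norm_smul, Real.norm_eq_abs]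
  gcongr
  exact L.norm_snd_le w

lemma continuous_nemytskii (hF : ∀ R : ℝ, ∃ K : ℝ≥0, LipschitzOnWith K
      (fun u : L.H Ω => nemytskii Ω f (L.toL2 Ω u)) (Metric.closedBall 0 R)) :
    Continuous fun u : L.H Ω => nemytskii Ω f (L.toL2 Ω u) := by
  rw [continuous_iff_continuousAt]
  intro u
  obtain ⟨K, hK⟩ := hF (‖u‖ + 1)
  refine hK.continuousOn.continuousAt
    (mem_of_superset (Metric.closedBall_mem_nhds u one_pos) ?_)
  exact Metric.closedBall_subset_closedBall' (by rw [dist_zero_right]; linarith)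

lemma continuous_fhat (hF : ∀ R : ℝ, ∃ K : ℝ≥0, LipschitzOnWith K
      (fun u : L.H Ω => nemytskii Ω f (L.toL2 Ω u)) (Metric.closedBall 0 R))
    (hβ : Continuous β) : Continuous fun p : ℝ × L.V Ω => L.fhat Ω f β p.1 p.2 := by
  refine (WithLp.prod_continuous_toLp 2 _ _).comp (continuous_const.prodMk ?_)
  have h1 : Continuous fun w : L.V Ω => w.fst := (WithLp.fstL 2 ℝ (L.H Ω) (L2 Ω)).continuous
  have h2 : Continuous fun w : L.V Ω => w.snd := (WithLp.sndL 2 ℝ (L.H Ω) (L2 Ω)).continuous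
  exact ((hβ.comp continuous_fst).smul (h2.comp continuous_snd)).neg.add
    ((L.continuous_nemytskii hF).comp (h1.comp continuous_snd))

lemma continuous_add_waveInv_fhat (hF : ∀ R : ℝ, ∃ K : ℝ≥0, LipschitzOnWith K
      (fun u : L.H Ω => nemytskii Ω f (L.toL2 Ω u)) (Metric.closedBall 0 R))
    (hβ : Continuous β) :
    Continuous fun p : ℝ × L.V Ω => p.2 + L.waveInv Ω (L.fhat Ω f β p.1 p.2) :=
  continuous_snd.add ((L.waveInv Ω).continuous.comp (L.continuous_fhat hF hβ))

lemma isLipschitzField_pulledField (hS : IsUnitaryGroup S (L.waveInv Ω))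
    (hF : ∀ R : ℝ, ∃ K : ℝ≥0, LipschitzOnWith K
      (fun u : L.H Ω => nemytskii Ω f (L.toL2 Ω u)) (Metric.closedBall 0 R))
    (hβ : Continuous β) : IsLipschitzField (L.pulledField S f β) where
  continuous z := hS.continuous_uncurry.comp (continuous_neg.prodMk
    ((L.continuous_fhat hF hβ).comp (continuous_id.prodMk (hS.continuous z))))
  lipschitz a b R := by
    obtain ⟨K, hK⟩ := hF R
    obtain ⟨B, hB⟩ := (isCompact_Icc (a := a) (b := b)).exists_bound_of_continuousOn hβ.continuousOn
    refine ⟨⟨|B| + K, by positivity⟩, fun t ht => LipschitzOnWith.of_dist_le_mul fun x hx y hy => ?_⟩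
    rw [mem_closedBall_zero_iff] at hx hy
    rw [dist_eq_norm, dist_eq_norm, pulledField, pulledField, ← map_sub, hS.norm_map,
      ← hS.norm_map t (x - y), map_sub]
    have hx' : (S t x).fst ∈ Metric.closedBall (0 : L.H Ω) R := by
      rw [mem_closedBall_zero_iff]
      exact (L.norm_fst_le _).trans (by rwa [hS.norm_map])
    have hy' : (S t y).fst ∈ Metric.closedBall (0 : L.H Ω) R := by
      rw [mem_closedBall_zero_iff]
      exact (L.norm_fst_le _).trans (by rwa [hS.norm_map])
    generalize S t x = p at *
    generalize S t y = q at *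
    have e : L.fhat Ω f β t p - L.fhat Ω f β t q = WithLp.toLp 2 (0, -(β t • (p - q).snd) +
        (nemytskii Ω f (L.toL2 Ω p.fst) - nemytskii Ω f (L.toL2 Ω q.fst))) := by
      refine WithLp.ofLp_injective 2 (Prod.ext ?_ ?_)
      · simp [fhat]
      · simp only [fhat, WithLp.ofLp_sub, Prod.snd_sub, WithLp.sub_snd, smul_sub]
        abel
    rw [e, norm_toLp_inr]
    refine (norm_add_le _ _).trans ?_
    rw [norm_neg, norm_smul]
    have h1 : ‖β t‖ ≤ |B| := (hB t ht).trans (le_abs_self B)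
    have h2 := hK.norm_sub_le hx' hy'
    have h3 := L.norm_snd_le (p - q)
    have h4 : ‖p.fst - q.fst‖ ≤ ‖p - q‖ := L.norm_fst_le (p - q)
    change _ ≤ (|B| + K) * ‖p - q‖
    calc _ ≤ |B| * ‖p - q‖ + K * ‖p - q‖ := by
          refine add_le_add (by gcongr) (h2.trans (by gcongr))
      _ = _ := by ring

variable {s : ℝ} {T : EReal} {w₀ : L.V Ω}

lemma apply_pulledField (hS : IsUnitaryGroup S (L.waveInv Ω)) (t : ℝ) (z : L.V Ω) :
    S t (L.pulledField S f β t z) = L.fhat Ω f β t (S t z) := hS.apply_neg_apply _ _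

lemma pulledField_neg_apply (hS : IsUnitaryGroup S (L.waveInv Ω)) (t : ℝ) (w : L.V Ω) :
    L.pulledField S f β t (S (-t) w) = S (-t) (L.fhat Ω f β t w) := by
  rw [pulledField, hS.apply_neg_apply]

lemma IsMildSolution.isIntegralSolution (hS : IsUnitaryGroup S (L.waveInv Ω)) {w : ℝ → L.V Ω}
    (hw : L.IsMildSolution Ω S f β s T w₀ w) :
    IsIntegralSolution (L.pulledField S f β) s T (S (-s) w₀) fun t => S (-t) (w t) where
  continuousOn := hS.continuous_uncurry.comp_continuousOn
    (continuous_neg.continuousOn.prodMk hw.continuousOn)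
  eq_integral t ht := by
    conv_lhs => rw [hw.formula t ht]
    rw [map_add, hS.apply_sub, hS.neg_apply_apply,
      ← ContinuousLinearMap.intervalIntegral_comp_comm _ (hw.intervalIntegrable t ht)]
    congr 1
    refine intervalIntegral.integral_congr fun τ _ => ?_
    simp only [L.pulledField_neg_apply hS]
    rw [hS.apply_sub, hS.neg_apply_apply]

lemma isMildSolution_of_isIntegralSolution (hS : IsUnitaryGroup S (L.waveInv Ω))
    (hG : IsLipschitzField (L.pulledField S f β)) {z : ℝ → L.V Ω}
    (hz : IsIntegralSolution (L.pulledField S f β) s T (S (-s) w₀) z) :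
    L.IsMildSolution Ω S f β s T w₀ fun t => S t (z t) := by
  have hint : ∀ t ∈ timeIco s T,
      IntervalIntegrable (fun τ => L.pulledField S f β τ (z τ)) volume s t := fun t ht => by
    refine ContinuousOn.intervalIntegrable ?_
    rw [uIcc_of_le ht.1]
    exact (hz.continuousOn_field hG).mono (Icc_subset_timeIco ht)
  have he : ∀ t τ, S (t - τ) (L.fhat Ω f β τ (S τ (z τ)))
      = S t (L.pulledField S f β τ (z τ)) := fun t τ => by
    rw [hS.apply_sub, pulledField]
  refine ⟨hS.continuous_uncurry.comp_continuousOn (continuousOn_id.prodMk hz.continuousOn),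
    fun t ht => ?_, fun t ht => ?_⟩
  · simp only [he]
    exact ⟨(S t).integrable_comp (hint t ht).1, (S t).integrable_comp (hint t ht).2⟩
  · simp only [he]
    rw [ContinuousLinearMap.intervalIntegral_comp_comm _ (hint t ht), hS.apply_sub, ← map_add,
      ← hz.eq_integral t ht]

/-- The equation in terms of `waveInv`: `(Â⁻¹ w)' = w + Â⁻¹ f̂(t, w)`. It makes sense in `V`
although `w` itself need not be differentiable. -/
lemma hasDerivWithinAt_waveInv (hS : IsUnitaryGroup S (L.waveInv Ω)) {z : ℝ → L.V Ω} {t : ℝ}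
    {D : Set ℝ} (hz : HasDerivWithinAt z (L.pulledField S f β t (z t)) D t) :
    HasDerivWithinAt (fun τ => L.waveInv Ω (S τ (z τ)))
      (S t (z t) + L.waveInv Ω (L.fhat Ω f β t (S t (z t)))) D t := by
  have h1 := hS.hasDerivWithinAt_apply ((L.waveInv Ω).hasFDerivAt.comp_hasDerivWithinAt t hz) rfl
  rw [hS.comm, L.apply_pulledField hS] at h1
  simpa [Function.comp_def, hS.comm] using h1

lemma hasDerivWithinAt_toL2_fst {w : ℝ → L.V Ω} {t : ℝ} {D : Set ℝ}
    (h : HasDerivWithinAt (fun τ => L.waveInv Ω (w τ))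
      (w t + L.waveInv Ω (L.fhat Ω f β t (w t))) D t) :
    HasDerivWithinAt (fun τ => L.toL2 Ω (w τ).fst) (w t).snd D t := by
  have h1 := (WithLp.sndL 2 ℝ (L.H Ω) (L2 Ω)).hasFDerivAt.comp_hasDerivWithinAt t h
  simpa [Function.comp_def, fhat] using h1

lemma hasDerivAt_inner_snd {w : ℝ → L.V Ω} {t : ℝ}
    (h : HasDerivAt (fun τ => L.waveInv Ω (w τ))
      (w t + L.waveInv Ω (L.fhat Ω f β t (w t))) t) (φ : L.H Ω) :
    HasDerivAt (fun τ => inner ℝ (w τ).snd (L.toL2 Ω φ))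
      (-inner ℝ (w t).fst φ + inner ℝ (L.fhat Ω f β t (w t)).snd (L.toL2 Ω φ)) t := by
  have h1 : HasDerivAt (fun τ => (L.waveInv Ω (w τ)).fst)
      (w t + L.waveInv Ω (L.fhat Ω f β t (w t))).fst t :=
    (WithLp.fstL 2 ℝ (L.H Ω) (L2 Ω)).hasFDerivAt.comp_hasDerivAt t h
  have h2 := (h1.inner ℝ (hasDerivAt_const t φ)).neg
  refine (h2.congr_deriv ?_).congr_of_eventuallyEq (Eventually.of_forall fun r => ?_)
  · rw [inner_zero_right, zero_add, WithLp.add_fst, waveInv_fst, inner_add_left, inner_neg_left,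
      ContinuousLinearMap.adjoint_inner_left]
    ring
  · simp only [Pi.neg_apply, waveInv_fst, inner_neg_left, ContinuousLinearMap.adjoint_inner_left,
      neg_neg]

/-- Solutions of `z' = G(t, z)` yield weak solutions. -/
lemma isWeakSolution_of_isIntegralSolution (hS : IsUnitaryGroup S (L.waveInv Ω))
    (hG : IsLipschitzField (L.pulledField S f β)) (hsT : (s : EReal) < T) {z : ℝ → L.V Ω}
    (hz : IsIntegralSolution (L.pulledField S f β) s T (S (-s) w₀) z) :
    L.IsWeakSolution Ω f β s T w₀ fun t => S t (z t) := by
  have hw := (L.isMildSolution_of_isIntegralSolution hS hG hz).continuousOn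
  have hK : ∀ t ∈ timeIoo s T, HasDerivAt (fun τ => L.waveInv Ω (S τ (z τ)))
      (S t (z t) + L.waveInv Ω (L.fhat Ω f β t (S t (z t)))) t := fun t ht => by
    rw [← hasDerivWithinAt_univ]
    exact L.hasDerivWithinAt_waveInv hS (hz.hasDerivAt hG ht).hasDerivWithinAt
  have hu : ∀ t ∈ timeIoo s T, HasDerivAt (fun τ => L.toL2 Ω (S τ (z τ)).fst) (S t (z t)).snd t :=
    fun t ht => by
      rw [← hasDerivWithinAt_univ]
      exact L.hasDerivWithinAt_toL2_fst (f := f) (β := β) (hK t ht).hasDerivWithinAt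
  refine ⟨(WithLp.fstL 2 ℝ (L.H Ω) (L2 Ω)).continuous.comp_continuousOn hw,
    contDiffOn_one_of_hasDerivAt (isOpen_timeIoo s T) hu
      ((WithLp.sndL 2 ℝ (L.H Ω) (L2 Ω)).continuous.comp_continuousOn
        (hw.mono (timeIoo_subset_timeIco s T))), hu, ?_, ?_, fun t ht φ => ?_⟩
  · rw [hz.initial hsT, hS.apply_neg_apply]
  · exact L.hasDerivWithinAt_toL2_fst (f := f) (β := β) (w := fun t => S t (z t))
      (L.hasDerivWithinAt_waveInv hS (hz.hasDerivWithinAt hG ⟨le_rfl, hsT⟩))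
  · refine ⟨_, L.hasDerivAt_inner_snd (hK t ht) φ, ?_⟩
    simp only [fhat_snd, inner_add_left, inner_neg_left, inner_smul_left, conj_trivial]
    ring

/-- The regularity `w ∈ C¹((s, T); L²(Ω) × H*)`. Under the Riesz isomorphism `v` corresponds to
`ι* v`, so `(u, v)` in `L²(Ω) × H*` is a bounded linear image of `K w`. -/
lemma contDiffOn_toL2_toDual (hS : IsUnitaryGroup S (L.waveInv Ω))
    (hF : ∀ R : ℝ, ∃ K : ℝ≥0, LipschitzOnWith K
      (fun u : L.H Ω => nemytskii Ω f (L.toL2 Ω u)) (Metric.closedBall 0 R))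
    (hβ : Continuous β) {z : ℝ → L.V Ω}
    (hz : IsIntegralSolution (L.pulledField S f β) s T (S (-s) w₀) z) :
    ContDiffOn ℝ 1 (fun t => (L.toL2 Ω (S t (z t)).fst, L.toDual Ω (S t (z t)).snd))
      (timeIoo s T) := by
  have hG := L.isLipschitzField_pulledField hS hF hβ
  have hw := ((L.isMildSolution_of_isIntegralSolution hS hG hz).continuousOn).mono
    (timeIoo_subset_timeIco s T)
  have hK : ContDiffOn ℝ 1 (fun τ => L.waveInv Ω (S τ (z τ))) (timeIoo s T) := by
    refine contDiffOn_one_of_hasDerivAt (isOpen_timeIoo s T) (fun t ht => ?_) 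
      ((L.continuous_add_waveInv_fhat hF hβ).comp_continuousOn (continuousOn_id.prodMk hw))
    rw [← hasDerivWithinAt_univ]
    exact L.hasDerivWithinAt_waveInv hS (hz.hasDerivAt hG ht).hasDerivWithinAt
  let P : L.V Ω →L[ℝ] L2 Ω × (L.H Ω →L[ℝ] ℝ) := (WithLp.sndL 2 ℝ (L.H Ω) (L2 Ω)).prod
    (-((innerSL ℝ : L.H Ω →L[ℝ] L.H Ω →L[ℝ] ℝ).comp (WithLp.fstL 2 ℝ (L.H Ω) (L2 Ω))))
  refine (P.contDiff.comp_contDiffOn hK).congr fun t _ => ?_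
  simp [P, toDual_eq]

end XEllipticOperator

/-! ### Weak solutions -/

namespace XEllipticOperator

section WeakSolutions

/-- Backward Gronwall estimate: a curve with `‖z'‖ ≤ B ‖z‖ + C` on `(s, b]` stays bounded as
time decreases to `s`. -/
lemma exists_bound_of_norm_deriv_le {E : Type*} [NormedAddCommGroup E] [NormedSpace ℝ E]
    {z g : ℝ → E} {s b B C : ℝ} (hB : 0 ≤ B) (hC : 0 ≤ C)
    (hz : ∀ t ∈ Ioc s b, HasDerivAt z (g t) t) (hg : ∀ t ∈ Ioc s b, ‖g t‖ ≤ B * ‖z t‖ + C) :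
    ∃ M, ∀ t ∈ Ioc s b, ‖z t‖ ≤ M := by
  refine ⟨gronwallBound ‖z b‖ B C (b - s), fun t ht => ?_⟩
  have hmem : ∀ τ ∈ Icc 0 (b - t), b - τ ∈ Ioc s b := fun τ hτ =>
    ⟨by linarith [hτ.2, ht.1], by linarith [hτ.1]⟩
  have hd : ∀ τ ∈ Icc 0 (b - t), HasDerivAt (fun τ => z (b - τ)) (-g (b - τ)) τ := by
    intro τ hτ
    have := (hz _ (hmem τ hτ)).scomp τ ((hasDerivAt_id τ).const_sub b)
    simpa [Function.comp_def] using this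
  have h := norm_le_gronwallBound_of_norm_deriv_right_le (f := fun τ => z (b - τ))
    (f' := fun τ => -g (b - τ)) (δ := ‖z b‖) (K := B) (ε := C) (a := 0) (b := b - t)
    (fun τ hτ => (hd τ hτ).continuousAt.continuousWithinAt)
    (fun τ hτ => (hd τ (Ico_subset_Icc_self hτ)).hasDerivWithinAt) (by simp)
    (fun τ hτ => by rw [norm_neg]; exact hg _ (hmem τ (Ico_subset_Icc_self hτ)))
    (b - t) ⟨by linarith [ht.2], le_rfl⟩
  simp only [sub_sub_cancel, sub_zero] at h
  exact h.trans (gronwallBound_mono (norm_nonneg _) hC hB (by linarith [ht.1]))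

/-- A curve with bounded derivative on `(s, b]` has a limit at `s`. -/
lemma exists_tendsto_of_norm_deriv_le {E : Type*} [NormedAddCommGroup E] [NormedSpace ℝ E]
    [CompleteSpace E] {z g : ℝ → E} {s b M : ℝ} (hsb : s < b)
    (hz : ∀ t ∈ Ioc s b, HasDerivAt z (g t) t) (hg : ∀ t ∈ Ioc s b, ‖g t‖ ≤ M) :
    ∃ y, Tendsto z (𝓝[>] s) (𝓝 y) := by
  have hL : LipschitzOnWith (Real.toNNReal M) z (Ioc s b) :=
    (convex_Ioc s b).lipschitzOnWith_of_nnnorm_hasDerivWithin_le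
      (fun t ht => (hz t ht).hasDerivWithinAt) fun t ht => by
        rw [← NNReal.coe_le_coe, coe_nnnorm]
        exact (hg t ht).trans (Real.le_coe_toNNReal M)
  have hc : Cauchy (𝓝[>] s) := cauchy_nhds.mono nhdsWithin_le_nhds
  have hle : 𝓝[>] s ≤ 𝓟 (Ioc s b) := le_principal_iff.2 (Ioc_mem_nhdsGT hsb)
  exact CompleteSpace.complete (hc.map_of_le hL.uniformContinuousOn hle)

variable {N m : ℕ} (L : XEllipticOperator N m) {Ω : Set (Eu N)}
variable {f β : ℝ → ℝ} {S : ℝ → L.V Ω →L[ℝ] L.V Ω} {s : ℝ} {T : EReal} {w₀ : L.V Ω}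

lemma IsWeakSolution.continuousOn_timeIoo {w : ℝ → L.V Ω}
    (hw : L.IsWeakSolution Ω f β s T w₀ w) : ContinuousOn w (timeIoo s T) := by
  have h1 : ContinuousOn (fun t => (w t).snd) (timeIoo s T) :=
    (hw.contDiffOn.continuousOn_deriv_of_isOpen (isOpen_timeIoo s T) le_rfl).congr
      fun t ht => (hw.hasDerivAt t ht).deriv.symm
  exact (WithLp.prod_continuous_toLp 2 _ _).comp_continuousOn
    ((hw.continuousOn.mono (timeIoo_subset_timeIco s T)).prodMk h1)

/-- A weak solution satisfies `(Â⁻¹ w)' = w + Â⁻¹ f̂(t, w)` in `V`. -/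
lemma IsWeakSolution.hasDerivAt_waveInv {w : ℝ → L.V Ω}
    (hF : ∀ R : ℝ, ∃ K : ℝ≥0, LipschitzOnWith K
      (fun u : L.H Ω => nemytskii Ω f (L.toL2 Ω u)) (Metric.closedBall 0 R))
    (hβ : Continuous β) (hw : L.IsWeakSolution Ω f β s T w₀ w) {t : ℝ} (ht : t ∈ timeIoo s T) :
    HasDerivAt (fun τ => L.waveInv Ω (w τ)) (w t + L.waveInv Ω (L.fhat Ω f β t (w t))) t := by
  have hc := hw.continuousOn_timeIoo
  have hg : ContinuousOn (fun t => w t + L.waveInv Ω (L.fhat Ω f β t (w t))) (timeIoo s T) :=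
    (L.continuous_add_waveInv_fhat hF hβ).comp_continuousOn (continuousOn_id.prodMk hc)
  have h1 : ∀ t ∈ timeIoo s T, HasDerivAt (fun τ => (L.waveInv Ω (w τ)).fst)
      (w t + L.waveInv Ω (L.fhat Ω f β t (w t))).fst t := by
    refine hasDerivAt_of_inner (denseRange_id (X := L.H Ω)) (isOpen_timeIoo s T)
      ((WithLp.fstL 2 ℝ (L.H Ω) (L2 Ω)).continuous.comp_continuousOn hg) fun φ τ hτ => ?_
    obtain ⟨D, hD, he⟩ := hw.equation τ hτ φ
    have h2 := hD.neg
    refine (h2.congr_deriv ?_).congr_of_eventuallyEq (Eventually.of_forall fun r => ?_)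
    · simp only [id_eq, WithLp.add_fst, waveInv_fst, fhat_snd, inner_add_left, inner_neg_left,
        ContinuousLinearMap.adjoint_inner_left, inner_smul_left, conj_trivial]
      linarith
    · simp only [id_eq, Pi.neg_apply, waveInv_fst, inner_neg_left,
        ContinuousLinearMap.adjoint_inner_left]
  have h2 : HasDerivAt (fun τ => (L.waveInv Ω (w τ)).snd)
      (w t + L.waveInv Ω (L.fhat Ω f β t (w t))).snd t := by
    refine (hw.hasDerivAt t ht).congr_deriv ?_
    rw [WithLp.add_snd, waveInv_snd, fhat_fst, map_zero, add_zero]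
  exact hasDerivAt_of_fst_of_snd (h1 t ht) h2

/-- In the interior of its interval, a weak solution `w` gives a classical solution
`z(t) = S(-t) w(t)` of `z' = G(t, z)`. -/
lemma IsWeakSolution.hasDerivAt_pullback {w : ℝ → L.V Ω} (hS : IsUnitaryGroup S (L.waveInv Ω))
    (hK : ∀ x, L.waveInv Ω x = 0 → x = 0)
    (hF : ∀ R : ℝ, ∃ K : ℝ≥0, LipschitzOnWith K
      (fun u : L.H Ω => nemytskii Ω f (L.toL2 Ω u)) (Metric.closedBall 0 R))
    (hβ : Continuous β) (hw : L.IsWeakSolution Ω f β s T w₀ w) {t : ℝ} (ht : t ∈ timeIoo s T) :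
    HasDerivAt (fun τ => S (-τ) (w τ)) (L.pulledField S f β t (S (-t) (w t))) t := by
  have hc := hw.continuousOn_timeIoo
  have hzc : ContinuousOn (fun τ => S (-τ) (w τ)) (timeIoo s T) :=
    hS.continuous_uncurry.comp_continuousOn (continuous_neg.continuousOn.prodMk hc)
  have hG := L.isLipschitzField_pulledField hS hF hβ
  -- Differentiate `K z(t) = S(-t) K w(t)`: the terms `S(-t) w(t)` cancel.
  have hKz : ∀ t ∈ timeIoo s T, HasDerivAt (fun τ => L.waveInv Ω (S (-τ) (w τ)))
      (L.waveInv Ω (L.pulledField S f β t (S (-t) (w t)))) t := by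
    intro t ht
    have h1 := hw.hasDerivAt_waveInv L hF hβ ht
    rw [← hasDerivWithinAt_univ] at h1 ⊢
    have h2 := hS.reverse.hasDerivWithinAt_apply h1 (x := -w t) (by simp)
    simp only [← map_add, neg_add_cancel_left] at h2
    rw [L.pulledField_neg_apply hS]
    simpa [hS.comm] using h2
  -- `⟨z, K x⟩ = -⟨K z, x⟩`, so the derivative of `K z` gives that of `z` tested with the dense
  -- range of `K`.
  refine hasDerivAt_of_inner (denseRange_of_skew (L.inner_waveInv Ω) hK) (isOpen_timeIoo s T)
    (hG.continuous_uncurry.comp_continuousOn (continuousOn_id.prodMk hzc)) (fun x τ hτ => ?_) t ht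
  have h3 := ((hKz τ hτ).inner ℝ (hasDerivAt_const τ x)).neg
  simp only [inner_zero_right, zero_add, inner_waveInv, neg_neg] at h3
  refine h3.congr_of_eventuallyEq (Eventually.of_forall fun r => ?_)
  simp

/-- A weak solution is continuous in `V` up to the initial time: the backward Gronwall inequality
gives a limit of `w` there, and the one-sided derivative of `u` identifies it. -/
lemma IsWeakSolution.tendsto_initial {w : ℝ → L.V Ω} (hS : IsUnitaryGroup S (L.waveInv Ω))
    (hK : ∀ x, L.waveInv Ω x = 0 → x = 0)
    (hF : ∀ R : ℝ, ∃ K : ℝ≥0, LipschitzOnWith K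
      (fun u : L.H Ω => nemytskii Ω f (L.toL2 Ω u)) (Metric.closedBall 0 R))
    (hβ : Continuous β) (hsT : (s : EReal) < T) (hw : L.IsWeakSolution Ω f β s T w₀ w) :
    Tendsto w (𝓝[>] s) (𝓝 (w s)) := by
  obtain ⟨b, hsb, hbT⟩ := EReal.lt_iff_exists_real_btwn.1 hsT
  have hsb' : s < b := EReal.coe_lt_coe_iff.1 hsb
  have hsub : Icc s b ⊆ timeIco s T := Icc_subset_timeIco ⟨hsb'.le, hbT⟩
  have hsubo : Ioc s b ⊆ timeIoo s T := fun t ht => ⟨ht.1, (hsub (Ioc_subset_Icc_self ht)).2⟩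
  obtain ⟨B, hB⟩ := (isCompact_Icc (a := s) (b := b)).exists_bound_of_continuousOn hβ.continuousOn
  obtain ⟨C, hC⟩ := (isCompact_Icc (a := s) (b := b)).exists_bound_of_continuousOn
    ((L.continuous_nemytskii hF).comp_continuousOn (hw.continuousOn.mono hsub))
  have hd : ∀ t ∈ Ioc s b, HasDerivAt (fun τ => S (-τ) (w τ))
      (L.pulledField S f β t (S (-t) (w t))) t := fun t ht =>
    hw.hasDerivAt_pullback L hS hK hF hβ (hsubo ht)
  have hle : ∀ t ∈ Ioc s b, ‖L.pulledField S f β t (S (-t) (w t))‖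
      ≤ |B| * ‖S (-t) (w t)‖ + |C| := by
    intro t ht
    have ht' := Ioc_subset_Icc_self ht
    rw [L.pulledField_neg_apply hS, hS.norm_map, hS.norm_map]
    refine (L.norm_fhat_le t (w t)).trans ?_
    exact add_le_add
      (mul_le_mul_of_nonneg_right ((hB t ht').trans (le_abs_self B)) (norm_nonneg _))
      ((hC t ht').trans (le_abs_self C))
  obtain ⟨M, hM⟩ := exists_bound_of_norm_deriv_le (abs_nonneg B) (abs_nonneg C) hd hle
  obtain ⟨y, hy⟩ := exists_tendsto_of_norm_deriv_le (M := |B| * M + |C|) hsb' hd fun t ht =>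
    (hle t ht).trans (by gcongr; exact hM t ht)
  have hlim : Tendsto w (𝓝[>] s) (𝓝 (S s y)) := by
    have hs : Tendsto (fun τ : ℝ => τ) (𝓝[>] s) (𝓝 s) := nhdsWithin_le_nhds
    refine ((hS.continuous_uncurry.tendsto (s, y)).comp (hs.prodMk_nhds hy)).congr fun τ => ?_
    exact hS.apply_neg_apply τ (w τ)
  have hmem : Ioc s b ∈ 𝓝[>] s := Ioc_mem_nhdsGT hsb'
  have hcs : ContinuousWithinAt (fun t => (w t).fst) (Ioc s b) s :=
    (hw.continuousOn s ⟨le_rfl, hsT⟩).mono (Ioc_subset_Icc_self.trans hsub)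
  have hfst : (S s y).fst = (w s).fst :=
    tendsto_nhds_unique (((WithLp.fstL 2 ℝ (L.H Ω) (L2 Ω)).continuous.tendsto _).comp hlim)
      (hcs.mono_of_mem_nhdsWithin hmem)
  have hsnd : (S s y).snd = (w s).snd := by
    have h1 : HasDerivWithinAt (fun τ => L.toL2 Ω (w τ).fst) (S s y).snd (Ici s) s := by
      refine hasDerivWithinAt_Ici_of_tendsto_deriv (s := Ioc s b)
        (fun t ht => (hw.hasDerivAt t (hsubo ht)).differentiableAt.differentiableWithinAt)
        ((L.toL2 Ω).continuous.continuousAt.comp_continuousWithinAt hcs) hmem ?_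
      refine (((WithLp.sndL 2 ℝ (L.H Ω) (L2 Ω)).continuous.tendsto _).comp hlim).congr' ?_
      filter_upwards [hmem] with t ht
      exact (hw.hasDerivAt t (hsubo ht)).deriv.symm
    exact (uniqueDiffWithinAt_Ici s).eq_deriv _ h1 hw.hasDerivWithinAt_initial
  rwa [WithLp.ofLp_injective 2 (Prod.ext hfst hsnd)] at hlim

/-- Weak solutions yield solutions of `z' = G(t, z)` up to the initial time. -/
lemma IsWeakSolution.isIntegralSolution {w : ℝ → L.V Ω} (hS : IsUnitaryGroup S (L.waveInv Ω))
    (hK : ∀ x, L.waveInv Ω x = 0 → x = 0)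
    (hF : ∀ R : ℝ, ∃ K : ℝ≥0, LipschitzOnWith K
      (fun u : L.H Ω => nemytskii Ω f (L.toL2 Ω u)) (Metric.closedBall 0 R))
    (hβ : Continuous β) (hsT : (s : EReal) < T) (hw : L.IsWeakSolution Ω f β s T w₀ w) :
    IsIntegralSolution (L.pulledField S f β) s T (S (-s) w₀) fun t => S (-t) (w t) := by
  have hc : ContinuousOn w (timeIco s T) := by
    rintro t ht
    rcases ht.1.eq_or_lt with rfl | h
    · have h1 : ContinuousWithinAt w (Ioi s) s := hw.tendsto_initial L hS hK hF hβ hsT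
      rw [continuousWithinAt_Ioi_iff_Ici] at h1
      exact h1.mono fun τ hτ => hτ.1
    · exact (hw.continuousOn_timeIoo.continuousAt
        ((isOpen_timeIoo s T).mem_nhds ⟨h, ht.2⟩)).continuousWithinAt
  have hz : ContinuousOn (fun t => S (-t) (w t)) (timeIco s T) :=
    hS.continuous_uncurry.comp_continuousOn (continuous_neg.continuousOn.prodMk hc)
  have hG := L.isLipschitzField_pulledField hS hF hβ
  refine ⟨hz, fun t ht => ?_⟩
  have hsub := Icc_subset_timeIco ht
  rw [intervalIntegral.integral_eq_sub_of_hasDerivAt_of_le ht.1 (hz.mono hsub)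
    (fun τ hτ => hw.hasDerivAt_pullback L hS hK hF hβ
      ⟨hτ.1, (hsub (Ioo_subset_Icc_self hτ)).2⟩)]
  · simp only [hw.initial]
    abel
  · refine ContinuousOn.intervalIntegrable ?_
    rw [uIcc_of_le ht.1]
    exact hG.continuous_uncurry.comp_continuousOn (continuousOn_id.prodMk (hz.mono hsub))

end WeakSolutions

end XEllipticOperator

end DampedWave

end

open DampedWave
theorem theorem3p3 {N m : ℕ} (L : XEllipticOperator N m) (Ω : Set (Eu N))
    (hΩ : IsOpen Ω) (hΩb : Bornology.IsBounded Ω)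
    (Q : ℝ) (hQ : 2 < Q) (hemb : L.SobolevEmbedding Ω Q)
    (f : ℝ → ℝ) (c γ : ℝ) (hc : 0 ≤ c) (hγ : 0 < γ) (hγQ : γ ≤ (2 * Q / (Q - 2) - 2) / 2)
    (hf : ∀ x y : ℝ, |f x - f y| ≤ c * |x - y| * (1 + |x| ^ γ + |y| ^ γ))
    (β : ℝ → ℝ) (hβ : Continuous β) (Cβ : ℝ) (hCβ : 1 ≤ Cβ)
    (hβ0 : ∀ t : ℝ, 1 ≤ (∫ τ in t..(t + 1), β τ) ∧ (∫ τ in t..(t + 1), β τ) ≤ Cβ)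
    (hβ1 : Integrable (fun t => max (-β t) 0)) :
    -- the superposition operator is well defined from `H` to `L²(Ω)`
    (∀ u : L.H Ω, MemLp (fun x => f (L.toL2 Ω u x)) 2 (volume.restrict Ω)) ∧
    -- `Â` generates a strongly continuous semigroup `S t = e^{tÂ}`
    ∃ S : ℝ → L.V Ω →L[ℝ] L.V Ω, IsSemigroupGeneratedBy S (L.graphAhat Ω) ∧
      ∀ (s : ℝ) (w₀ : L.V Ω), ∃ (T : EReal) (w : ℝ → L.V Ω), (s : EReal) < T ∧
        -- existence on `[s, T)`, the variation of constants formula, and regularity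
        L.IsWeakSolution Ω f β s T w₀ w ∧
        L.IsMildSolution Ω S f β s T w₀ w ∧
        ContinuousOn w (timeIco s T) ∧
        ContDiffOn ℝ 1 (fun t => (L.toL2 Ω (w t).fst, L.toDual Ω (w t).snd)) (timeIoo s T) ∧
        -- uniqueness and maximality of `[s, T)`
        (∀ (T' : EReal) (w' : ℝ → L.V Ω), (s : EReal) < T' →
          (L.IsWeakSolution Ω f β s T' w₀ w' ∨ L.IsMildSolution Ω S f β s T' w₀ w') →
          T' ≤ T ∧ EqOn w' w (timeIco s T')) ∧
        -- blow-up alternative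
        (T = ⊤ ∨ ∃ T₀ : ℝ, T = T₀ ∧ limsup (fun t => ‖w t‖ₑ) (𝓝[<] T₀) = ⊤) := by
  have hK : ∀ x, L.waveInv Ω x = 0 → x = 0 := L.waveInv_injective
    (fun _ => L.toL2_injective hΩ hΩb hQ hemb) (L.denseRange_toL2 hΩ hΩb hQ hemb)
  have hF := L.exists_lipschitzOnWith_nemytskii hΩb hQ hemb hc hγ hγQ hf
  obtain ⟨S, hS⟩ := exists_isUnitaryGroup (L.inner_waveInv Ω) hK
  have hG := L.isLipschitzField_pulledField hS hF hβ
  refine ⟨L.memLp_comp_toL2 hΩb hQ hemb hc hγ hγQ hf, S, ?_, fun s w₀ => ?_⟩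
  · rw [L.graphAhat_eq]
    exact hS.isSemigroupGeneratedBy
  · obtain ⟨T, z, hsT, hz, hmax, hblow⟩ := hG.exists_maximal s (S (-s) w₀)
    have hmild := L.isMildSolution_of_isIntegralSolution hS hG hz
    refine ⟨T, fun t => S t (z t), hsT, L.isWeakSolution_of_isIntegralSolution hS hG hsT hz, hmild,
      hmild.continuousOn, L.contDiffOn_toL2_toDual hS hF hβ hz, fun T' w' hsT' hw' => ?_, ?_⟩
    · have hz' : IsIntegralSolution (L.pulledField S f β) s T' (S (-s) w₀)
          fun t => S (-t) (w' t) :=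
        hw'.elim (fun h => h.isIntegralSolution L hS hK hF hβ hsT')
          fun h => h.isIntegralSolution L hS
      obtain ⟨h1, h2⟩ := hmax T' _ hsT' hz'
      refine ⟨h1, fun t ht => ?_⟩
      simp only [← h2 ht, hS.apply_neg_apply]
    · have he : ∀ t, ‖S t (z t)‖ₑ = ‖z t‖ₑ := fun t => by
        rw [← ofReal_norm, ← ofReal_norm, hS.norm_map]
      simpa only [he] using hblow
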